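/- Let $\triangle ABC$ be an equilateral triangle in the Euclidean plane, drawn with $BC$ horizontal, $B$ to the left of $C$, and $A$ above $BC$. A *nonsingular trajectory* is a piecewise linear curve $\alpha:\mathbb R\to\triangle ABC$ of constant positive speed that never meets a vertex, bends only on the sides, and there obeys the law that the angle of incidence equals the angle of reflection. A *periodic orbit* is the restriction to $[a,b]$, $a<b$, of a nonsingular trajectory with $\alpha(a+t)=\alpha(b+t)$ for all $t\in\mathbb R$; its *period* is the number of times the ball strikes a side during $[a,b)$. Periodic orbits that differ only by a relabelling of the vertices (a symmetry of the triangle), the choice of initial point, the direction, or the speed are regarded as the same orbit. Let $\gamma$ be Fagnano's orbit, which runs once round the triangle whose vertices are the midpoints of the sides, and let $\gamma^j$ be its $j$-fold iterate, which runs round it $j$ times. Let $\mathcal T$ be the tessellation of the plane by equilateral triangles congruent to $\triangle ABC$ that contains $\triangle ABC$. Given an orbit of period $m$, parametrize and label it so that it begins and ends at a point $P$ of $BC$ and leaves $P$ to the right at an angle between $30^\circ$ and $60^\circ$ with $BC$. Let $\sigma_1$ be the reflection in the side struck first after $P$ and, inductively, let $\sigma_{i+1}$ be the reflection in the line of $\mathcal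 T$ containing the image under $\sigma_i\cdots\sigma_1$ of the $(i+1)$-st side struck. The directed segment $\underline{PQ}$ with $Q=\sigma_{m-1}\cdots\sigma_1(P)$ is called an *unfolding* of the orbit. Two periodic orbits are *equivalent* if a horizontal translation carries some unfolding of one to some unfolding of the other, and $[\alpha]$ denotes the set of periodic orbits equivalent to $\alpha$. Call $O$ a *fundamental origin* if it is a point of $BC$ other than the midpoint such that, for each unfolding $\underline{PQ}$ of each orbit of even period, the translate of $\underline{PQ}$ that begins at $O$ contains no vertex of $\mathcal T$. The rhombic coordinates $(x,y)$ with origin $O$ denote the point $O+x\,\overrightarrow{BC}+y\,\overrightarrow{BA}$. **Theorem (Classification).** Fundamental origins exist. For every fundamental origin $O$ and every periodic orbit $\alpha$ on $\triangle ABC$: 1. If $\alpha$ has even period $2n$, then $[\alpha]$ has the cardinality $\mathfrak c$ of the continuum, and there are integers $x,y$ with $0\le x\le y$, $x\equiv y\pmod 3$ and $x+y=n$ such that exactly one orbit in $[\alpha]$ has $\underline{OS}$ with $S=(x,y)$ as an unfolding; moreover, every unfolding beginning at $O$ of an orbit in $[\alpha]$ ends at this point $S$. In particular, $[\alpha]$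 contains exactly one representative with an unfolding $\underline{OS}$ that begins at $O$. 2. Otherwise $\alpha=\gamma^{2k-1}$ for some $k\ge 1$, and its period is $6k-3$. -/

import Mathlib

open scoped Cardinal

noncomputable section

namespace Billiard

/-- The Euclidean plane. -/
abbrev Plane : Type := EuclideanSpace ℝ (Fin 2)

variable (T : Affine.Triangle ℝ Plane)

/-! The vertices `T.points 0`, `T.points 1`, `T.points 2` of the billiard table are called `A`, `B`
and `C`. The side `BC` is regarded as horizontal, with `B` on the left and `A` above it. -/

/-- The side opposite to the vertex `i`, as a segment; side `0` is `BC`. -/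
def side (i : Fin 3) : Set Plane := segment ℝ (T.points (i + 1)) (T.points (i + 2))

/-- The line containing the side opposite to the vertex `i`. -/
def sideLine (i : Fin 3) : AffineSubspace ℝ Plane :=
  line[ℝ, T.points (i + 1), T.points (i + 2)]

/-- At time `t` the curve `α` departs with velocity `w`. -/
def DepartsWith (α : ℝ → Plane) (t : ℝ) (w : Plane) : Prop :=
  ∃ ε > 0, ∀ h ∈ Set.Icc (0 : ℝ) ε, α (t + h) = α t + h • w

/-- At time `t` the curve `α` arrives with velocity `u`. -/
def ArrivesWith (α : ℝ → Plane) (t : ℝ) (u : Plane) : Prop :=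
  ∃ ε > 0, ∀ h ∈ Set.Icc (0 : ℝ) ε, α (t - h) = α t - h • u

/-- A nonsingular trajectory: a piecewise linear curve in the table, defined for all times, that
never meets a vertex, has constant positive speed `c`, changes its velocity only on the sides, and
there by the law that the angle of incidence equals the angle of reflection. (A trajectory cannot
run along a side, as it would then reach a vertex.) -/
structure IsNonsingularTrajectory (α : ℝ → Plane) : Prop where
  mem_table : ∀ t, α t ∈ T.closedInterior
  ne_vertex : ∀ t i, α t ≠ T.points i
  motion : ∃ c : ℝ, 0 < c ∧ ∀ t, ∃ u w : Plane, ‖u‖ = c ∧ ‖w‖ = c ∧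
    ArrivesWith α t u ∧ DepartsWith α t w ∧
    ((∀ i, α t ∉ side T i) → w = u) ∧
    (∀ i, α t ∈ side T i → w = (sideLine T i).direction.reflection u)

/-- A periodic orbit with a chosen parametrization: the restriction of a periodic nonsingular
trajectory to an interval `[a, b]`, where `b - a > 0` is a period of the trajectory (not
necessarily the least one). -/
structure PeriodicCurve where
  /-- the trajectory -/
  toFun : ℝ → Plane
  /-- the initial time -/
  a : ℝ
  /-- the final time -/
  b : ℝ
  a_lt_b : a < b
  nonsingular : IsNonsingularTrajectory T toFun
  periodic : ∀ t, toFun (a + t) = toFun (b + t)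

variable {T}

/-- The times at which the ball strikes a bumper. -/
def PeriodicCurve.strikes (α : PeriodicCurve T) : Set ℝ := {t | ∃ i, α.toFun t ∈ side T i}

/-- The period of a periodic orbit: the number of times the ball strikes a bumper (the initial and
the final time are the same moment of the orbit, and are counted once). -/
def PeriodicCurve.period (α : PeriodicCurve T) : ℕ := (Set.Ico α.a α.b ∩ α.strikes).ncard

variable (T) in
/-- A relabelling of the vertices: an isometry of the plane that permutes them. -/
def IsRelabelling (ρ : Plane ≃ᵃⁱ[ℝ] Plane) : Prop :=
  ∃ σ : Equiv.Perm (Fin 3), ∀ i, ρ (T.points i) = T.points (σ i)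

/-- Two parametrized periodic orbits are the same orbit if they differ by a relabelling of the
vertices, the choice of the initial point, the direction of the parameter and the speed. The
condition on the lengths of the intervals says that the same number of rounds is made. -/
def PeriodicCurve.Same (α β : PeriodicCurve T) : Prop :=
  ∃ ρ : Plane ≃ᵃⁱ[ℝ] Plane, IsRelabelling T ρ ∧ ∃ m s : ℝ, m ≠ 0 ∧
    (∀ t, β.toFun (m * t + s) = ρ (α.toFun t)) ∧ β.b - β.a = |m| * (α.b - α.a)

theorem PeriodicCurve.same_equivalence : Equivalence (PeriodicCurve.Same (T := T)) where
  refl α := ⟨AffineIsometryEquiv.refl ℝ Plane, ⟨Equiv.refl _, fun _ => rfl⟩, 1, 0, one_ne_zero,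
    fun t => by simp, by simp⟩
  symm := by
    rintro α β ⟨ρ, ⟨σ, hσ⟩, m, s, hm, h, hl⟩
    refine ⟨ρ.symm, ⟨σ.symm, fun i => ?_⟩, m⁻¹, -(m⁻¹ * s), inv_ne_zero hm, fun t => ?_, ?_⟩
    · rw [AffineIsometryEquiv.symm_apply_eq, hσ, Equiv.apply_symm_apply]
    · have h' := h (m⁻¹ * t + -(m⁻¹ * s))
      have e : m * (m⁻¹ * t + -(m⁻¹ * s)) + s = t := by field_simp; ring
      rw [e] at h'
      rw [h', AffineIsometryEquiv.symm_apply_apply]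
    · rw [hl, abs_inv, inv_mul_cancel_left₀ (abs_ne_zero.mpr hm)]
  trans := by
    rintro α β δ ⟨ρ, ⟨σ, hσ⟩, m, s, hm, h, hl⟩ ⟨ρ', ⟨σ', hσ'⟩, m', s', hm', h', hl'⟩
    refine ⟨ρ.trans ρ', ⟨σ.trans σ', fun i => ?_⟩, m' * m, m' * s + s', mul_ne_zero hm' hm,
      fun t => ?_, ?_⟩
    · simp [hσ, hσ']
    · have e : m' * m * t + (m' * s + s') = m' * (m * t + s) + s' := by ring
      rw [e, h', h]
      rfl
    · rw [hl', hl, abs_mul, mul_assoc]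

variable (T) in
/-- The identification of parametrized periodic orbits. -/
def orbitSetoid : Setoid (PeriodicCurve T) := ⟨PeriodicCurve.Same, PeriodicCurve.same_equivalence⟩

variable (T) in
/-- The periodic orbits, irrespective of labels, initial point, direction and speed. -/
def Orbit : Type := Quotient (orbitSetoid T)

/-- The periodic orbit given by a parametrized one. -/
def PeriodicCurve.orbit (α : PeriodicCurve T) : Orbit T := Quotient.mk (orbitSetoid T) α

/-! ### Unfoldings -/

/-- `t 0 < t 1 < ⋯` are all the strike times of `α` from its initial time on, the orbit begins on a
bumper (`t 0 = a`), and side `k i` is struck at time `t i`. -/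
structure IsStrikeSequence (α : PeriodicCurve T) (t : ℕ → ℝ) (k : ℕ → Fin 3) : Prop where
  zero : t 0 = α.a
  strictMono : StrictMono t
  range : Set.range t = Set.Ici α.a ∩ α.strikes
  mem_side : ∀ i, α.toFun (t i) ∈ side T (k i)

variable (T) in
/-- The composition `σ_n ∘ ⋯ ∘ σ_1`, where `σ_(i+1)` is the reflection in the line of the
tessellation that contains the side `k (i+1)` of the triangle `(σ_i ∘ ⋯ ∘ σ_1) (ABC)`. -/
def unfoldMap (k : ℕ → Fin 3) : ℕ → (Plane ≃ᵃⁱ[ℝ] Plane)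
  | 0 => AffineIsometryEquiv.refl ℝ Plane
  | i + 1 => (unfoldMap k i).trans (EuclideanGeometry.reflection
      line[ℝ, unfoldMap k i (T.points (k (i + 1) + 1)), unfoldMap k i (T.points (k (i + 1) + 2))])

/-- The directed segment from `P` to `Q` is the unfolding of the parametrized orbit `α`: it begins
and ends at the point `P` of `BC`, and leaves `BC` at `P` to the right, at an angle between `30°`
and `60°`. If its period is `n`, then `Q` is `(σ_(n-1) ∘ ⋯ ∘ σ_1) P`. -/
def PeriodicCurve.UnfoldsTo (α : PeriodicCurve T) (P Q : Plane) : Prop :=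
  α.toFun α.a = P ∧ P ∈ side T 0 ∧
  (∃ w, DepartsWith α.toFun α.a w ∧
    InnerProductGeometry.angle w (T.points 2 - T.points 1)
      ∈ Set.Icc (Real.pi / 6) (Real.pi / 3)) ∧
  ∃ (t : ℕ → ℝ) (k : ℕ → Fin 3), IsStrikeSequence α t k ∧ Q = unfoldMap T k (α.period - 1) P

/-- The directed segment from `P` to `Q` is an unfolding of the orbit `o`: after a relabelling of
the vertices, a change of the initial point and a change of direction if necessary. -/
def Orbit.IsUnfolding (o : Orbit T) (P Q : Plane) : Prop :=
  ∃ α : PeriodicCurve T, α.orbit = o ∧ α.UnfoldsTo P Q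

/-- Two periodic orbits are equivalent if a horizontal translation, by a vector `v` parallel
to `BC`, carries an unfolding of the first to an unfolding of the second. -/
def Orbit.Equivalent (o o' : Orbit T) : Prop :=
  ∃ P Q R S v : Plane, o.IsUnfolding P Q ∧ o'.IsUnfolding R S ∧
    (∃ r : ℝ, v = r • (T.points 2 - T.points 1)) ∧ R = P + v ∧ S = Q + v

/-- The equivalence class `[o]`. -/
def Orbit.cls (o : Orbit T) : Set (Orbit T) := {o' | o.Equivalent o'}

variable (T)

/-- The point with rhombic coordinates `(x, y)` with respect to the origin `O`: the `x`-axis is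
horizontal, the `y`-axis is parallel to `BA`, and `BC` is the unit of length. -/
def rhombic (O : Plane) (x y : ℝ) : Plane :=
  O + x • (T.points 2 - T.points 1) + y • (T.points 0 - T.points 1)

/-- The vertices of the tessellation by triangles congruent to `ABC`. -/
def tessellationVertices : Set Plane := {V | ∃ x y : ℤ, V = rhombic T (T.points 1) x y}

/-- `O` is an admissible origin of fundamental unfoldings: a point of `BC` other than its midpoint
such that no unfolding of an orbit of even period contains a vertex of the tessellation after it
is translated to begin at `O`. -/
structure IsFundamentalOrigin (O : Plane) : Prop where
  mem_side : O ∈ side T 0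
  ne_midpoint : O ≠ midpoint ℝ (T.points 1) (T.points 2)
  nonsingular : ∀ α : PeriodicCurve T, Even α.period → ∀ P Q, α.orbit.IsUnfolding P Q →
    Disjoint (segment ℝ O (Q + (O - P))) (tessellationVertices T)

/-! ### The orbit of Fagnano -/

/-- The midpoint of the side opposite to the vertex `j` modulo `3`. -/
def sideMidpoint (j : ℤ) : Plane :=
  let i : Fin 3 := (j : ZMod 3)
  midpoint ℝ (T.points (i + 1)) (T.points (i + 2))

/-- The trajectory of Fagnano on an equilateral triangle: it runs round the orthic triangle, whose
vertices are the midpoints of the sides, one side of it per unit of time. -/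
def fagnano (t : ℝ) : Plane :=
  AffineMap.lineMap (sideMidpoint T ⌊t⌋) (sideMidpoint T (⌊t⌋ + 1)) (Int.fract t)

variable {T} in
/-- `α` is the `j`-fold iterate `γ ^ j` of the orbit of Fagnano `γ`: it runs `j` times round the
orthic triangle (from any initial point, in either direction, at any speed). -/
def PeriodicCurve.IsFagnanoIterate (α : PeriodicCurve T) (j : ℕ) : Prop :=
  ∃ m s : ℝ, m ≠ 0 ∧ (∀ t, α.toFun t = fagnano T (m * t + s)) ∧ |m| * (α.b - α.a) = 3 * j

end Billiard

end

noncomputable section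

namespace Billiard

variable {T : Affine.Triangle ℝ Plane}

/-! ### The tessellation in rhombic coordinates -/

/-! Measure in rhombic coordinates from `B`. The reflections in the three sides then act as an
explicit group: one of six integral linear maps followed by a translation `(k, l)` with `3 ∣ k - l`.
The table is a fundamental domain for it (`exists_rel_tri`, `Rel.eq_of_tri`). Since each bounce
applies an element of this group to the velocity and fixes the position, the whole trajectory is the
image of one straight line (`IsNonsingularTrajectory.rel_line`); it avoids vertices exactly because
the line does, and strikes a side exactly when the line crosses the tessellation. Conversely a line
that misses all vertices folds to a trajectory (`foldedLine_isNonsingularTrajectory`).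

Going once round a periodic orbit yields a group element that moves its line along itself. A
rotation fixes no direction. If the element is a translation by `(k, l)`, counting crossings of the
three families of parallels gives the period `|k| + |l| + |k + l|`, which is even. If it is a glide
reflection, the line runs midway between two parallels of the tessellation, so it folds to Fagnano's
orbit run round an odd number of times (`translation_or_glide`,
`PeriodicCurve.translation_or_fagnano`). The parity of the period thus separates the two cases.

An unfolding is a piece of this line (`PeriodicCurve.unfoldsTo_iff`). Relabelling and reversal
change the period vector by the symmetries of a regular hexagon, for which the sector between 30°
and 60° is a fundamental domain; so the vector of an unfolding depends only on the orbit, and in the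
even case it is an integral vector `(x, y)` with `0 ≤ x ≤ y` and `x + y` half the period. A
horizontal translation compares nothing else: a class is the set of orbits with a given vector, and
inside it the initial point of an unfolding determines the orbit. At a fundamental origin the line
in that direction misses the vertices, so it does come from an orbit, and from only one.

For the cardinality, initial points give an injection of the class into the reals. In the other
direction every irrational abscissa in `(0, 1)` starts some unfolding of the class, while one orbit
accounts for only countably many abscissas. -/

/-- The barycentric coordinates of the point with rhombic coordinates `p`. -/
def bary (i : Fin 3) (p : ℝ × ℝ) : ℝ := ![p.2, 1 - p.1 - p.2, p.1] i

/-- The linear part of `bary`. -/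
def dbary (i : Fin 3) (v : ℝ × ℝ) : ℝ := ![v.2, -v.1 - v.2, v.1] i

/-- The reflection in the direction of the side `i`. -/
def refl (i : Fin 3) (v : ℝ × ℝ) : ℝ × ℝ :=
  ![(v.1 + v.2, -v.2), (-v.2, -v.1), (-v.1, v.1 + v.2)] i

/-- The square of the length, in units of the side. -/
def normSq (v : ℝ × ℝ) : ℝ := v.1 ^ 2 + v.1 * v.2 + v.2 ^ 2

/-- The elements of the point group generated by the reflections `refl i`. -/
def pointGroup (i : Fin 6) (v : ℝ × ℝ) : ℝ × ℝ :=
  ![v, (-v.1 - v.2, v.1), (v.2, -v.1 - v.2), (v.1 + v.2, -v.2), (-v.2, -v.1),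
    (-v.1, v.1 + v.2)] i

/-- An element of the group generated by the reflections in the sides moves the point `p` with
velocity `v` to the point `q` with velocity `w`. -/
def Rel (p v q w : ℝ × ℝ) : Prop :=
  ∃ (i : Fin 6) (k l : ℤ), 3 ∣ k - l ∧ q = pointGroup i p + ((k : ℝ), (l : ℝ)) ∧
    w = pointGroup i v

/-- The point `p` belongs to the table. -/
def Tri (p : ℝ × ℝ) : Prop := ∀ i, 0 ≤ bary i p

/-- The point `p` is a vertex of the tessellation. -/
def IsLat (p : ℝ × ℝ) : Prop := ∃ k l : ℤ, p = ((k : ℝ), (l : ℝ))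

/-- The three families of lines of the tessellation are the level sets at integers of these
functions. -/
def fam (j : Fin 3) (p : ℝ × ℝ) : ℝ := ![p.1, p.2, p.1 + p.2] j

/-- The point `p` lies on a line of the tessellation. -/
def OnGrid (p : ℝ × ℝ) : Prop := ∃ (j : Fin 3) (n : ℤ), fam j p = n

theorem tri_iff {p : ℝ × ℝ} : Tri p ↔ 0 ≤ p.1 ∧ 0 ≤ p.2 ∧ p.1 + p.2 ≤ 1 := by
  simp only [Tri, Fin.forall_fin_succ, bary]
  simp
  constructor <;> rintro ⟨h1, h2, h3⟩ <;> refine ⟨?_, ?_, ?_⟩ <;> linarith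

theorem bary_add_smul (i : Fin 3) (p v : ℝ × ℝ) (h : ℝ) :
    bary i (p + h • v) = bary i p + h * dbary i v := by
  fin_cases i <;> simp [bary, dbary] <;> ring

theorem sum_bary (p : ℝ × ℝ) : ∑ i, bary i p = 1 := by
  simp [Fin.sum_univ_three, bary]

/-- The right side is symmetric in the three labels, so lengths are visibly unchanged by
relabelling. -/
theorem normSq_eq (v : ℝ × ℝ) : normSq v = (∑ i, dbary i v ^ 2) / 2 := by
  simp [Fin.sum_univ_three, dbary, normSq]; ring

/-- A form of the reflection that is uniform in the labels, and hence commutes with permuting them.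
-/
theorem dbary_refl (i j : Fin 3) (v : ℝ × ℝ) :
    dbary j (refl i v) = if j = i then -dbary i v else dbary j v + dbary i v := by
  fin_cases i <;> fin_cases j <;> simp [dbary, refl] <;> ring

theorem refl_refl (i : Fin 3) (v : ℝ × ℝ) : refl i (refl i v) = v := by
  fin_cases i <;> ext <;> simp [refl]

theorem ext_bary {p q : ℝ × ℝ} (h : ∀ i, bary i p = bary i q) : p = q := by
  have h0 := h 0
  have h2 := h 2
  simp [bary] at h0 h2
  exact Prod.ext h2 h0

theorem ext_dbary {v w : ℝ × ℝ} (h : ∀ i, dbary i v = dbary i w) : v = w := by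
  have h0 := h 0
  have h2 := h 2
  simp [dbary] at h0 h2
  exact Prod.ext h2 h0

theorem pointGroup_add_smul (i : Fin 6) (p v : ℝ × ℝ) (h : ℝ) :
    pointGroup i (p + h • v) = pointGroup i p + h • pointGroup i v := by
  fin_cases i <;> ext <;> simp [pointGroup] <;> ring

theorem pointGroup_add (i : Fin 6) (p v : ℝ × ℝ) :
    pointGroup i (p + v) = pointGroup i p + pointGroup i v := by
  simpa using pointGroup_add_smul i p v 1

theorem pointGroup_smul (i : Fin 6) (v : ℝ × ℝ) (h : ℝ) :
    pointGroup i (h • v) = h • pointGroup i v := by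
  fin_cases i <;> ext <;> simp [pointGroup] <;> ring

theorem pointGroup_zero (i : Fin 6) : pointGroup i 0 = 0 := by
  simpa using pointGroup_smul i 0 0

theorem pointGroup_comp (i j : Fin 6) :
    ∃ k, ∀ v, pointGroup i (pointGroup j v) = pointGroup k v := by
  fin_cases i <;> fin_cases j <;> first
    | (refine ⟨0, fun v => ?_⟩; ext <;> simp [pointGroup] <;> ring1)
    | (refine ⟨1, fun v => ?_⟩; ext <;> simp [pointGroup] <;> ring1)
    | (refine ⟨2, fun v => ?_⟩; ext <;> simp [pointGroup] <;> ring1)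
    | (refine ⟨3, fun v => ?_⟩; ext <;> simp [pointGroup] <;> ring1)
    | (refine ⟨4, fun v => ?_⟩; ext <;> simp [pointGroup] <;> ring1)
    | (refine ⟨5, fun v => ?_⟩; ext <;> simp [pointGroup] <;> ring1)

theorem pointGroup_inv (i : Fin 6) : ∃ k, ∀ v, pointGroup k (pointGroup i v) = v := by
  fin_cases i
  · exact ⟨0, fun v => by ext <;> simp [pointGroup]⟩
  · exact ⟨2, fun v => by ext <;> simp [pointGroup]⟩
  · exact ⟨1, fun v => by ext <;> simp [pointGroup]; ring⟩
  · exact ⟨3, fun v => by ext <;> simp [pointGroup]⟩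
  · exact ⟨4, fun v => by ext <;> simp [pointGroup]⟩
  · exact ⟨5, fun v => by ext <;> simp [pointGroup]⟩

theorem pointGroup_int (i : Fin 6) (k l : ℤ) : ∃ k' l' : ℤ,
    pointGroup i ((k : ℝ), (l : ℝ)) = ((k' : ℝ), (l' : ℝ)) ∧ (3 ∣ k - l → 3 ∣ k' - l') := by
  fin_cases i
  · exact ⟨k, l, by simp [pointGroup], fun h => h⟩
  · exact ⟨-k - l, k, by simp [pointGroup], fun h => by omega⟩
  · exact ⟨l, -k - l, by simp [pointGroup], fun h => by omega⟩
  · exact ⟨k + l, -l, by simp [pointGroup], fun h => by omega⟩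
  · exact ⟨-l, -k, by simp [pointGroup], fun h => by omega⟩
  · exact ⟨-k, k + l, by simp [pointGroup], fun h => by omega⟩

theorem normSq_pointGroup (i : Fin 6) (v : ℝ × ℝ) : normSq (pointGroup i v) = normSq v := by
  fin_cases i <;> simp [pointGroup, normSq] <;> ring

theorem normSq_pos {v : ℝ × ℝ} (hv : v ≠ 0) : 0 < normSq v := by
  have h : normSq v = (v.1 + v.2 / 2) ^ 2 + 3 / 4 * v.2 ^ 2 := by simp [normSq]; ring
  rw [h]
  by_cases h2 : v.2 = 0
  · have h1 : v.1 ≠ 0 := fun h1 => hv (Prod.ext h1 h2)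
    rw [h2]
    have := pow_pos (abs_pos.2 h1) 2
    rw [sq_abs] at this
    nlinarith
  · have := pow_pos (abs_pos.2 h2) 2
    rw [sq_abs] at this
    nlinarith [sq_nonneg (v.1 + v.2 / 2)]

theorem Rel.refl (p v : ℝ × ℝ) : Rel p v p v :=
  ⟨0, 0, 0, by simp, by ext <;> simp [pointGroup], by simp [pointGroup]⟩

theorem Rel.trans {p v q w r u : ℝ × ℝ} (h : Rel p v q w) (h' : Rel q w r u) : Rel p v r u := by
  obtain ⟨i, k, l, hd, rfl, rfl⟩ := h
  obtain ⟨j, k', l', hd', rfl, rfl⟩ := h'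
  obtain ⟨m, hm⟩ := pointGroup_comp j i
  obtain ⟨k'', l'', he, hd''⟩ := pointGroup_int j k l
  refine ⟨m, k'' + k', l'' + l', by have := hd'' hd; omega, ?_, hm v⟩
  rw [pointGroup_add, hm, he]
  ext <;> simp <;> ring

theorem Rel.symm {p v q w : ℝ × ℝ} (h : Rel p v q w) : Rel q w p v := by
  obtain ⟨i, k, l, hd, rfl, rfl⟩ := h
  obtain ⟨j, hj⟩ := pointGroup_inv i
  obtain ⟨k', l', he, hd'⟩ := pointGroup_int j k l
  refine ⟨j, -k', -l', by have := hd' hd; omega, ?_, (hj v).symm⟩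
  rw [pointGroup_add, hj, he]
  ext <;> simp

theorem Rel.add_smul {p v q w : ℝ × ℝ} (h : Rel p v q w) (c : ℝ) :
    Rel (p + c • v) v (q + c • w) w := by
  obtain ⟨i, k, l, hd, rfl, rfl⟩ := h
  refine ⟨i, k, l, hd, ?_, rfl⟩
  rw [pointGroup_add_smul]
  abel

/-- The case `c = 0` forgets velocities: `Rel p 0 q 0` relates positions only. -/
theorem Rel.smul {p v q w : ℝ × ℝ} (h : Rel p v q w) (c : ℝ) : Rel p (c • v) q (c • w) := by
  obtain ⟨i, k, l, hd, rfl, rfl⟩ := h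
  exact ⟨i, k, l, hd, rfl, (pointGroup_smul _ _ _).symm⟩

theorem Rel.point {p v q w : ℝ × ℝ} (h : Rel p v q w) : Rel p 0 q 0 := by
  simpa using h.smul 0

theorem rel_add_int (p v : ℝ × ℝ) {k l : ℤ} (h : 3 ∣ k - l) :
    Rel p v (p + ((k : ℝ), (l : ℝ))) v :=
  ⟨0, k, l, h, by simp [pointGroup], by simp [pointGroup]⟩

/-- The reflection in the line of side `i` belongs to the group and fixes the points of that line.
Only side `1`, which misses the origin `B`, needs a translation, by `(1, 1)`. -/
theorem rel_refl_of_bary_eq_zero {i : Fin 3} {p : ℝ × ℝ} (h : bary i p = 0) (v : ℝ × ℝ) :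
    Rel p v p (Billiard.refl i v) := by
  fin_cases i <;> simp [bary] at h
  · exact ⟨3, 0, 0, by simp, by ext <;> simp [pointGroup, h], by simp [pointGroup, Billiard.refl]⟩
  · refine ⟨4, 1, 1, by simp, ?_, by simp [pointGroup, Billiard.refl]⟩
    ext <;> simp [pointGroup] <;> linarith
  · exact ⟨5, 0, 0, by simp, by ext <;> simp [pointGroup, h], by simp [pointGroup, Billiard.refl]⟩

/-- The group preserves the vertices of the tessellation, so missing them can be checked on the
unfolded line or in the table alike. -/
theorem Rel.isLat {p v q w : ℝ × ℝ} (h : Rel p v q w) (hp : IsLat p) : IsLat q := by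
  obtain ⟨i, k, l, -, rfl, -⟩ := h
  obtain ⟨k', l', rfl⟩ := hp
  obtain ⟨k'', l'', he, -⟩ := pointGroup_int i k' l'
  exact ⟨k'' + k, l'' + l, by rw [he]; ext <;> simp⟩

theorem Rel.fam {p v q w : ℝ × ℝ} (h : Rel p v q w) {j : Fin 3} {n : ℤ} (hp : fam j p = n) :
    ∃ (j' : Fin 3) (n' : ℤ), Billiard.fam j' q = n' ∧
      |Billiard.fam j' w| = |Billiard.fam j v| := by
  obtain ⟨i, k, l, -, rfl, rfl⟩ := h
  -- The linear parts permute the three families of parallels up to sign.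
  have key : ∃ (j' : Fin 3) (s : ℤ), (s = 1 ∨ s = -1) ∧
      ∀ x, Billiard.fam j' (pointGroup i x) = s * Billiard.fam j x := by
    fin_cases i <;> fin_cases j <;> first
      | (refine ⟨0, 1, Or.inl rfl, fun x => ?_⟩; simp [pointGroup, Billiard.fam]; done)
      | (refine ⟨1, 1, Or.inl rfl, fun x => ?_⟩; simp [pointGroup, Billiard.fam]; done)
      | (refine ⟨2, 1, Or.inl rfl, fun x => ?_⟩; simp [pointGroup, Billiard.fam]; done)
      | (refine ⟨0, -1, Or.inr rfl, fun x => ?_⟩; simp [pointGroup, Billiard.fam] <;> ring1)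
      | (refine ⟨1, -1, Or.inr rfl, fun x => ?_⟩; simp [pointGroup, Billiard.fam] <;> ring1)
      | (refine ⟨2, -1, Or.inr rfl, fun x => ?_⟩; simp [pointGroup, Billiard.fam] <;> ring1)
  obtain ⟨j', s, hs, hj⟩ := key
  have hsum : ∃ m : ℤ, Billiard.fam j' ((k : ℝ), (l : ℝ)) = m := by
    fin_cases j'
    · exact ⟨k, by simp [Billiard.fam]⟩
    · exact ⟨l, by simp [Billiard.fam]⟩
    · exact ⟨k + l, by simp [Billiard.fam]⟩
  obtain ⟨m, hm⟩ := hsum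
  refine ⟨j', s * n + m, ?_, ?_⟩
  · have : ∀ x y, Billiard.fam j' (x + y) = Billiard.fam j' x + Billiard.fam j' y := by
      intro x y
      fin_cases j' <;> simp [Billiard.fam]; ring
    rw [this, hj, hp, hm]; push_cast; ring
  · rw [hj, abs_mul]
    rcases hs with rfl | rfl <;> simp

theorem Rel.onGrid {p v q w : ℝ × ℝ} (h : Rel p v q w) (hp : OnGrid p) : OnGrid q := by
  obtain ⟨j, n, hn⟩ := hp
  obtain ⟨j', n', hn', -⟩ := h.fam hn
  exact ⟨j', n', hn'⟩

theorem Rel.normSq {p v q w : ℝ × ℝ} (h : Rel p v q w) :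
    Billiard.normSq w = Billiard.normSq v := by
  obtain ⟨i, k, l, -, -, rfl⟩ := h
  exact normSq_pointGroup i v

/-- The table is a fundamental domain: it contains at most one point of each orbit. -/
theorem Rel.eq_of_tri {p v q w : ℝ × ℝ} (h : Rel p v q w) (hp : Tri p) (hq : Tri q) : p = q := by
  obtain ⟨i, k, l, hd, rfl, -⟩ := h
  rw [tri_iff] at hp hq
  obtain ⟨x, y⟩ := p
  obtain ⟨hx, hy, hxy⟩ := hp
  obtain ⟨h1, h2, h3⟩ := hq
  dsimp only at hx hy hxy
  -- Two points of the table are close, so only small translations occur; the congruence modulo 3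
  -- then leaves six pairs.
  have hb : (-2 < k ∧ k < 3) ∧ (-2 < l ∧ l < 3) := by
    rw [← Int.cast_lt (R := ℝ), ← Int.cast_lt (R := ℝ) (m := k),
      ← Int.cast_lt (R := ℝ) (n := l), ← Int.cast_lt (R := ℝ) (m := l)]
    fin_cases i <;> simp [pointGroup] at h1 h2 h3 <;> push_cast <;>
      refine ⟨⟨?_, ?_⟩, ?_, ?_⟩ <;> linarith
  obtain ⟨⟨hk1, hk2⟩, hl1, hl2⟩ := hb
  have hkl : (k = -1 ∧ l = -1) ∨ (k = -1 ∧ l = 2) ∨ (k = 0 ∧ l = 0) ∨ (k = 1 ∧ l = 1) ∨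
    (k = 2 ∧ l = -1) ∨ (k = 2 ∧ l = 2) := by omega
  rcases hkl with ⟨rfl, rfl⟩ | ⟨rfl, rfl⟩ | ⟨rfl, rfl⟩ | ⟨rfl, rfl⟩ | ⟨rfl, rfl⟩ | ⟨rfl, rfl⟩ <;>
    fin_cases i <;> refine Prod.ext ?_ ?_ <;> simp [pointGroup] at h1 h2 h3 ⊢ <;> linarith

/-- The table is a fundamental domain: it contains a point of each orbit. -/
theorem exists_rel_tri (p v : ℝ × ℝ) : ∃ q w, Rel p v q w ∧ Tri q := by
  obtain ⟨x, y⟩ := p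
  have hx := Int.floor_le x
  have hx' := Int.lt_floor_add_one x
  have hy := Int.floor_le y
  have hy' := Int.lt_floor_add_one y
  generalize ⌊x⌋ = i at *
  generalize ⌊y⌋ = j at *
  obtain ⟨r, j', hr, hj, hd⟩ : ∃ r j' : ℤ, (r = 0 ∨ r = 1 ∨ r = 2) ∧ j = j' + r ∧ 3 ∣ i - j' :=
    ⟨(j - i) % 3, j - (j - i) % 3, by omega, by omega, by omega⟩
  subst hj
  have main : ∀ (m : Fin 6) (k l : ℤ), 3 ∣ k - l →
      Tri (pointGroup m (x, y) + ((k : ℝ), (l : ℝ))) →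
      ∃ q w, Rel (x, y) v q w ∧ Tri q := fun m k l h ht =>
    ⟨_, _, ⟨m, k, l, h, rfl, rfl⟩, ht⟩
  -- The diagonal cuts the unit rhombus into two triangles; with the residue `r` there are six types
  -- of triangle, one for each element of the point group.
  have h := le_total (x + y) (i + ((j' + r : ℤ) : ℝ) + 1)
  rcases hr with rfl | rfl | rfl <;> push_cast at hy hy' h <;> rcases h with h | h
  · exact main 0 (-i) (-j') (by omega) (by
      rw [tri_iff]; simp [pointGroup]; refine ⟨?_, ?_, ?_⟩ <;> linarith)
  · exact main 4 (j' + 1) (i + 1) (by omega) (by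
      rw [tri_iff]; simp [pointGroup]; refine ⟨?_, ?_, ?_⟩ <;> linarith)
  · exact main 2 (-1 - j') (2 + i + j') (by omega) (by
      rw [tri_iff]; simp [pointGroup]; refine ⟨?_, ?_, ?_⟩ <;> linarith)
  · exact main 5 (1 + i) (-2 - i - j') (by omega) (by
      rw [tri_iff]; simp [pointGroup]; refine ⟨?_, ?_, ?_⟩ <;> linarith)
  · exact main 1 (3 + i + j') (-i) (by omega) (by
      rw [tri_iff]; simp [pointGroup]; refine ⟨?_, ?_, ?_⟩ <;> linarith)
  · exact main 3 (-3 - i - j') (3 + j') (by omega) (by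
      rw [tri_iff]; simp [pointGroup]; refine ⟨?_, ?_, ?_⟩ <;> linarith)

/-- A line of the tessellation that meets the table either carries a side or touches the table in a
vertex only. -/
theorem Tri.exists_bary_eq_zero {q : ℝ × ℝ} (hq : Tri q) (hl : ¬ IsLat q) {j : Fin 3} {n : ℤ}
    (h : fam j q = n) : ∃ i, bary i q = 0 ∧ ∀ w, |dbary i w| = |fam j w| := by
  rw [tri_iff] at hq
  obtain ⟨h1, h2, h3⟩ := hq
  have hn : (0 : ℝ) ≤ n ∧ (n : ℝ) ≤ 1 := by
    rw [← h]
    fin_cases j <;> simp [fam] <;> constructor <;> linarith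
  have hn' : n = 0 ∨ n = 1 := by
    have h0 : 0 ≤ n := by exact_mod_cast hn.1
    have h1 : n ≤ 1 := by exact_mod_cast hn.2
    omega
  fin_cases j <;> simp [fam] at h ⊢ <;> rcases hn' with rfl | rfl
  · exact ⟨2, by simp [bary, h], fun a b => by simp [dbary]⟩
  · exact absurd ⟨1, 0, Prod.ext (by simp [h]) (by simp at h ⊢; linarith)⟩ hl
  · exact ⟨0, by simp [bary, h], fun a b => by simp [dbary]⟩
  · exact absurd ⟨0, 1, Prod.ext (by simp at h ⊢; linarith) (by simp [h])⟩ hl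
  · exact absurd ⟨0, 0, Prod.ext (by simp at h ⊢; linarith) (by simp at h ⊢; linarith)⟩ hl
  · refine ⟨1, by simp [bary] at h ⊢; linarith, fun a b => ?_⟩
    have : dbary 1 (a, b) = -(a + b) := by simp [dbary]; ring
    rw [this, abs_neg]

theorem onGrid_of_bary_eq_zero {q : ℝ × ℝ} {i : Fin 3} (h : bary i q = 0) : OnGrid q := by
  fin_cases i <;> simp [bary] at h
  · exact ⟨1, 0, by simp [fam, h]⟩
  · exact ⟨2, 1, by simp [fam]; linarith⟩
  · exact ⟨0, 0, by simp [fam, h]⟩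

theorem isLat_of_two_bary_eq_zero {q : ℝ × ℝ} {i j : Fin 3} (hij : i ≠ j) (hi : bary i q = 0)
    (hj : bary j q = 0) : IsLat q := by
  obtain ⟨x, y⟩ := q
  fin_cases i <;> fin_cases j <;> simp [bary] at hi hj hij
  · exact ⟨1, 0, by simp; constructor <;> linarith⟩
  · exact ⟨0, 0, by simp; constructor <;> linarith⟩
  · exact ⟨1, 0, by simp; constructor <;> linarith⟩
  · exact ⟨0, 1, by simp; constructor <;> linarith⟩
  · exact ⟨0, 0, by simp; constructor <;> linarith⟩
  · exact ⟨0, 1, by simp; constructor <;> linarith⟩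

/-- The vertices of the tessellation in the table are the vertices of the table. -/
theorem Tri.exists_of_isLat {q : ℝ × ℝ} (hq : Tri q) (hl : IsLat q) :
    ∃ i, ∀ j, bary j q = if j = i then 1 else 0 := by
  obtain ⟨k, l, rfl⟩ := hl
  rw [tri_iff] at hq
  obtain ⟨h1, h2, h3⟩ := hq
  dsimp only at h1 h2 h3
  have h1' : 0 ≤ k := by exact_mod_cast h1
  have h2' : 0 ≤ l := by exact_mod_cast h2
  have h3' : k + l ≤ 1 := by exact_mod_cast h3
  have hc : (k = 0 ∧ l = 0) ∨ (k = 1 ∧ l = 0) ∨ (k = 0 ∧ l = 1) := by omega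
  rcases hc with ⟨rfl, rfl⟩ | ⟨rfl, rfl⟩ | ⟨rfl, rfl⟩
  · exact ⟨1, fun j => by fin_cases j <;> simp [bary]⟩
  · exact ⟨2, fun j => by fin_cases j <;> simp [bary]⟩
  · exact ⟨0, fun j => by fin_cases j <;> simp [bary]⟩

/-- A line that runs along a line of the tessellation meets a vertex. -/
theorem exists_isLat_of_fam {j : Fin 3} {n : ℤ} {p v : ℝ × ℝ} (hv : v ≠ 0) (hp : fam j p = n)
    (h : fam j v = 0) : ∃ c : ℝ, IsLat (p + c • v) := by
  obtain ⟨x, y⟩ := p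
  obtain ⟨a, b⟩ := v
  fin_cases j <;> simp [fam] at hp h
  · have hb : b ≠ 0 := fun hb => hv (Prod.ext h hb)
    exact ⟨-y / b, n, 0, by simp [h, hp]; field_simp; ring⟩
  · have ha : a ≠ 0 := fun ha => hv (Prod.ext ha h)
    exact ⟨-x / a, 0, n, by simp [h, hp]; field_simp; ring⟩
  · have ha : a ≠ 0 := fun ha => hv (Prod.ext ha (by simp; linarith))
    obtain rfl : b = -a := by linarith
    obtain rfl : y = n - x := by linarith
    exact ⟨-x / a, 0, n, by simp; field_simp; simp⟩

theorem fam_add_smul (j : Fin 3) (p v : ℝ × ℝ) (h : ℝ) :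
    fam j (p + h • v) = fam j p + h * fam j v := by
  fin_cases j <;> simp [fam]; ring

/-! ### Directions and the sector between 30° and 60° -/

/-- The sector of the directions between `30°` and `60°`. -/
def Sector (v : ℝ × ℝ) : Prop := 0 ≤ v.1 ∧ v.1 ≤ v.2

/-- The point group together with `-1` has order 12, and this 30° sector is a fundamental domain for
it. -/
theorem Sector.eq {v w : ℝ × ℝ} (hv : Sector v) (hw : Sector w) {i : Fin 6} {s : ℝ}
    (hs : s = 1 ∨ s = -1) (h : w = s • pointGroup i v) : v = w := by
  obtain ⟨a, b⟩ := v
  obtain ⟨hv1, hv2⟩ := hv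
  subst h
  obtain ⟨hw1, hw2⟩ := hw
  rcases hs with rfl | rfl <;> fin_cases i <;> refine Prod.ext ?_ ?_ <;>
    simp [pointGroup] at hv1 hv2 hw1 hw2 ⊢ <;> linarith

/-- Some family of lines of the tessellation is crossed at an angle between `30°` and `60°`. -/
theorem exists_middle_fam (v : ℝ × ℝ) : ∃ j, fam j v ^ 2 ≤ normSq v ∧ normSq v ≤ 3 * fam j v ^ 2 := by
  obtain ⟨a, b⟩ := v
  rcases le_total 0 a with ha | ha <;> rcases le_total 0 b with hb | hb <;>
  rcases le_total a b with hab | hab <;> rcases le_total 0 (a + b) with hc | hc <;>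
  rcases le_total 0 (2 * a + b) with hd | hd <;> rcases le_total 0 (a + 2 * b) with hf | hf <;>
  first
  | (refine ⟨0, ?_, ?_⟩ <;> simp [fam, normSq] <;> nlinarith)
  | (refine ⟨1, ?_, ?_⟩ <;> simp [fam, normSq] <;> nlinarith)
  | (refine ⟨2, ?_, ?_⟩ <;> simp [fam, normSq] <;> nlinarith)

theorem fam_ne_zero_of_middle {j : Fin 3} {v : ℝ × ℝ} (hv : v ≠ 0)
    (h : normSq v ≤ 3 * fam j v ^ 2) : fam j v ≠ 0 := by
  intro h0
  rw [h0] at h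
  have := normSq_pos hv
  simp at h
  linarith

/-- The sine of the angle with the horizontal is `√3 / 2 * v.2 / √(normSq v)`; the last two
hypotheses bound it by `√3 / 2` and `1 / 2`, and `h1` says that `v` does not point to the left. -/
theorem sector_of_middle {v : ℝ × ℝ} (h2 : 0 < v.2) (h1 : 0 ≤ 2 * v.1 + v.2)
    (hl : v.2 ^ 2 ≤ normSq v) (hu : normSq v ≤ 3 * v.2 ^ 2) : Sector v := by
  obtain ⟨a, b⟩ := v
  simp [normSq, Sector] at *
  constructor <;> by_contra! hh <;> nlinarith

/-! ### Rhombic coordinates of the Euclidean plane -/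

variable (T)

/-- The vector with rhombic coordinates `v`. -/
def frameMap : (ℝ × ℝ) →ₗ[ℝ] Plane :=
  (LinearMap.toSpanSingleton ℝ Plane (T.points 2 - T.points 1)).coprod
    (LinearMap.toSpanSingleton ℝ Plane (T.points 0 - T.points 1))

theorem frameMap_apply (v : ℝ × ℝ) : frameMap T v =
    v.1 • (T.points 2 - T.points 1) + v.2 • (T.points 0 - T.points 1) := by
  simp [frameMap]

theorem frameMap_injective : Function.Injective (frameMap T) := by
  rw [injective_iff_map_eq_zero]
  intro v hv
  rw [frameMap_apply] at hv
  have h := (affineIndependent_iff (k := ℝ) (p := T.points)).1 T.independent Finset.univ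
    ![v.2, -v.1 - v.2, v.1] (by simp [Fin.sum_univ_three]) (by
      refine (Fin.sum_univ_three _).trans ?_
      rw [← hv]
      simp
      module)
  have h0 := h 0 (Finset.mem_univ _)
  have h2 := h 2 (Finset.mem_univ _)
  simp at h0 h2
  exact Prod.ext h2 h0

/-- The isomorphism of the coordinate plane with the Euclidean plane. -/
def frame : (ℝ × ℝ) ≃ₗ[ℝ] Plane :=
  LinearEquiv.ofInjectiveOfFinrankEq (frameMap T) (frameMap_injective T) (by simp)

theorem frame_apply (v : ℝ × ℝ) : frame T v =
    v.1 • (T.points 2 - T.points 1) + v.2 • (T.points 0 - T.points 1) :=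
  frameMap_apply T v

/-- The rhombic coordinates of a vector. -/
def cv (u : Plane) : ℝ × ℝ := (frame T).symm u

/-- The rhombic coordinates, with origin `B`, of a point. -/
def co (p : Plane) : ℝ × ℝ := (frame T).symm (p - T.points 1)

theorem frame_cv (u : Plane) : frame T (cv T u) = u := by simp [cv]

theorem cv_frame (v : ℝ × ℝ) : cv T (frame T v) = v := by simp [cv]

theorem cv_smul (c : ℝ) (u : Plane) : cv T (c • u) = c • cv T u := by simp [cv]

theorem cv_sub_eq_co_sub (p u : Plane) : cv T (p - u) = co T p - co T u := by
  simp [cv, co]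

theorem cv_injective : Function.Injective (cv T) := (frame T).symm.injective

theorem co_injective : Function.Injective (co T) := fun p q h => by
  have := (frame T).symm.injective h
  simpa using this

theorem co_add (p u : Plane) : co T (p + u) = co T p + cv T u := by
  rw [co, co, cv, ← map_add]; congr 1; abel

theorem co_add_smul (p u : Plane) (h : ℝ) : co T (p + h • u) = co T p + h • cv T u := by
  rw [co_add, cv_smul]

theorem co_sub_smul (p u : Plane) (h : ℝ) : co T (p - h • u) = co T p + (-h) • cv T u := by
  rw [← co_add_smul]; congr 1; module

/-- The point with given coordinates. -/
def pt (p : ℝ × ℝ) : Plane := T.points 1 + frame T p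

theorem co_pt (p : ℝ × ℝ) : co T (pt T p) = p := by simp [co, pt]

theorem pt_co (p : Plane) : pt T (co T p) = p := by simp [co, pt]

theorem pt_add_smul (p v : ℝ × ℝ) (h : ℝ) : pt T (p + h • v) = pt T p + h • frame T v := by
  simp only [pt, map_add, map_smul]; abel

theorem pt_eq_sum (p : ℝ × ℝ) : pt T p = ∑ i, bary i p • T.points i := by
  rw [pt, frame_apply, Fin.sum_univ_three]
  simp [bary]
  module

theorem bary_co_sum (a : Fin 3 → ℝ) (ha : ∑ i, a i = 1) (j : Fin 3) :
    bary j (co T (∑ i, a i • T.points i)) = a j := by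
  have : ∑ i, a i • T.points i = pt T (a 2, a 0) := by
    rw [pt_eq_sum]
    rw [Fin.sum_univ_three] at ha
    have : 1 - a 2 - a 0 = a 1 := by linarith
    simp [Fin.sum_univ_three, bary, this]
  rw [this, co_pt]
  rw [Fin.sum_univ_three] at ha
  fin_cases j <;> simp [bary]
  linarith

theorem sum_bary_co (p : Plane) : ∑ i, bary i (co T p) • T.points i = p := by
  rw [← pt_eq_sum, pt_co]

theorem co_points (i j : Fin 3) : bary j (co T (T.points i)) = if j = i then 1 else 0 := by
  have := bary_co_sum T (fun k => if k = i then 1 else 0) (by simp) j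
  simpa using this

theorem eq_points_iff (p : Plane) (i : Fin 3) :
    p = T.points i ↔ ∀ j, bary j (co T p) = if j = i then 1 else 0 := by
  refine ⟨fun h j => by rw [h, co_points], fun h => co_injective T (ext_bary fun j => ?_)⟩
  rw [h, co_points]

theorem mem_closedInterior_iff (p : Plane) : p ∈ T.closedInterior ↔ Tri (co T p) := by
  have h := T.affineCombination_mem_closedInterior_iff (w := fun i => bary i (co T p))
    (sum_bary _)
  rw [Finset.affineCombination_eq_linear_combination _ _ _ (sum_bary _), sum_bary_co] at h
  rw [h]
  refine ⟨fun h i => (h i).1, fun h i => ⟨h i, ?_⟩⟩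
  rw [← sum_bary (co T p)]
  exact Finset.single_le_sum (f := fun i => bary i (co T p)) (fun j _ => h j) (Finset.mem_univ i)

theorem mem_side_iff (p : Plane) (i : Fin 3) :
    p ∈ side T i ↔ Tri (co T p) ∧ bary i (co T p) = 0 := by
  have hs : ∀ a : Fin 3 → ℝ, ∑ j, a j = a i + a (i + 1) + a (i + 2) := by
    intro a; rw [Fin.sum_univ_three]; fin_cases i <;> simp <;> ring
  have hs' : ∀ a : Fin 3 → Plane, ∑ j, a j = a i + a (i + 1) + a (i + 2) := by
    intro a; rw [Fin.sum_univ_three]; fin_cases i <;> simp <;> abel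
  constructor
  · rintro ⟨a, b, ha, hb, hab, rfl⟩
    have h1 : i + 1 ≠ i := by fin_cases i <;> simp
    have h2 : i + 2 ≠ i := by fin_cases i <;> simp
    have h3 : i + 2 ≠ i + 1 := by fin_cases i <;> simp
    have key := bary_co_sum T (fun j => if j = i then 0 else if j = i + 1 then a else b)
      (by rw [hs]; simp [h1, h2, h3, hab])
    rw [hs'] at key
    simp only [h1, h2, h3, if_true, if_false, zero_smul, zero_add] at key
    refine ⟨fun j => ?_, by rw [key]; simp⟩
    rw [key]
    split_ifs <;> simp [*]
  · rintro ⟨ht, h⟩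
    refine ⟨_, _, ht (i + 1), ht (i + 2), ?_, ?_⟩
    · have := hs (fun j => bary j (co T p))
      rw [sum_bary, h] at this
      linarith
    · have := hs' (fun j => bary j (co T p) • T.points j)
      rw [sum_bary_co, h] at this
      rw [zero_smul, zero_add] at this
      exact this.symm

theorem rhombic_eq (O : Plane) (x y : ℝ) : rhombic T O x y = O + frame T (x, y) := by
  simp [rhombic, frame_apply, add_assoc]

theorem mem_tessellationVertices_iff (p : Plane) :
    p ∈ tessellationVertices T ↔ IsLat (co T p) := by
  simp only [tessellationVertices, Set.mem_ofPred_eq, IsLat]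
  refine exists_congr fun x => exists_congr fun y => ?_
  rw [rhombic_eq]
  constructor
  · rintro rfl
    exact co_pt T (x, y)
  · intro h
    rw [← pt_co T p, h]; rfl

variable {T}

/-- The vectors `BC` and `BA` have equal length `s` and inner product `s ^ 2 / 2`. -/
theorem inner_points (hT : T.Equilateral) : ∃ s : ℝ, 0 < s ∧
    ∀ u w : Plane, inner ℝ u w = s ^ 2 * ((cv T u).1 * (cv T w).1 + (cv T u).2 * (cv T w).2 +
      ((cv T u).1 * (cv T w).2 + (cv T u).2 * (cv T w).1) / 2) := by
  obtain ⟨s, hs⟩ := hT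
  have h21 := hs 2 1 (by decide)
  have h01 := hs 0 1 (by decide)
  have h20 := hs 2 0 (by decide)
  rw [dist_eq_norm] at h21 h01 h20
  have hpos : 0 < s := by
    rw [← h21, norm_pos_iff, sub_ne_zero]
    exact fun h => absurd (T.independent.injective h) (by decide)
  have e : inner ℝ (T.points 2 - T.points 1) (T.points 0 - T.points 1) = s ^ 2 / 2 := by
    have : T.points 2 - T.points 0 = (T.points 2 - T.points 1) - (T.points 0 - T.points 1) := by
      abel
    have h := norm_sub_sq_real (T.points 2 - T.points 1) (T.points 0 - T.points 1)
    rw [← this, h20, h21, h01] at h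
    linarith
  refine ⟨s, hpos, fun u w => ?_⟩
  conv_lhs => rw [← frame_cv T u, ← frame_cv T w]
  rw [frame_apply, frame_apply]
  simp only [inner_add_left, inner_add_right, real_inner_smul_left, real_inner_smul_right,
    real_inner_self_eq_norm_sq, h21, h01, e,
    real_inner_comm (T.points 2 - T.points 1) (T.points 0 - T.points 1)]
  ring

theorem norm_sq_eq (hT : T.Equilateral) : ∃ s : ℝ, 0 < s ∧
    ∀ u : Plane, ‖u‖ = s * Real.sqrt (normSq (cv T u)) := by
  obtain ⟨s, hs, h⟩ := inner_points hT
  refine ⟨s, hs, fun u => ?_⟩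
  have h1 := h u u
  rw [real_inner_self_eq_norm_sq] at h1
  have h2 : s ^ 2 * normSq (cv T u) = ‖u‖ ^ 2 := by rw [h1, normSq]; ring
  have h3 : Real.sqrt (s ^ 2 * normSq (cv T u)) = ‖u‖ := by
    rw [h2, Real.sqrt_sq (norm_nonneg _)]
  rw [← h3, Real.sqrt_mul (sq_nonneg s), Real.sqrt_sq hs.le]

theorem cv_reflection (hT : T.Equilateral) (i : Fin 3) (u : Plane) :
    cv T ((sideLine T i).direction.reflection u) = refl i (cv T u) := by
  obtain ⟨s, hs, hin⟩ := inner_points hT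
  have hdir : (sideLine T i).direction = ℝ ∙ (T.points (i + 2) - T.points (i + 1)) := by
    rw [sideLine, direction_affineSpan, vectorSpan_pair_rev]; rfl
  -- The directions of the sides in coordinates, read off from the barycentric coordinates of their
  -- end points.
  have hcv : cv T (T.points (i + 2) - T.points (i + 1)) = ![(1, 0), (-1, 1), (0, -1)] i := by
    rw [cv_sub_eq_co_sub]
    apply ext_dbary
    intro j
    have e : ∀ p q, dbary j (p - q) = bary j p - bary j q := by
      intro p q
      fin_cases j <;> simp [dbary, bary]; ring
    rw [e, co_points, co_points]
    fin_cases i <;> fin_cases j <;> simp [dbary]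
  simp only [hdir]
  have hnorm := hin (T.points (i + 2) - T.points (i + 1)) (T.points (i + 2) - T.points (i + 1))
  rw [real_inner_self_eq_norm_sq] at hnorm
  have hsub : ∀ x y : Plane, cv T (x - y) = cv T x - cv T y := fun x y => by simp [cv]
  have hsm : ∀ (n : ℕ) (x : Plane), cv T (n • x) = n • cv T x := fun n x => by simp [cv]
  have hs0 := hs.ne'
  rw [Submodule.reflection_singleton_apply, hsub, hsm, cv_smul, hin]
  norm_cast
  rw [hnorm, hcv]
  fin_cases i <;> ext <;> simp [refl] <;> field_simp <;> ring

section Line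

variable {α : ℝ → Plane}

/-! ### Trajectories unfold to straight lines -/

/-- A locally constant property is constant on a connected open set. The motion is given only
locally at each time, so this replaces an induction over the bounces and needs no prior finiteness.
-/
theorem forall_mem_of_locally {s : Set ℝ} (hs : IsPreconnected s) (ho : IsOpen s) {P : ℝ → Prop}
    (h : ∀ t ∈ s, ∀ᶠ x in nhds t, P x ↔ P t) {a : ℝ} (ha : a ∈ s) (hPa : P a) :
    ∀ t ∈ s, P t := by
  have hopen : ∀ Q : ℝ → Prop, (∀ t ∈ s, ∀ᶠ x in nhds t, Q x ↔ Q t) →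
      IsOpen {t | t ∈ s ∧ Q t} := by
    intro Q hQ
    rw [isOpen_iff_mem_nhds]
    rintro t ⟨hts, hQt⟩
    filter_upwards [hQ t hts, ho.mem_nhds hts] with x hx hxs
    exact ⟨hxs, hx.2 hQt⟩
  have h1 := hopen P h
  have h2 := hopen (fun t => ¬ P t) fun t ht => (h t ht).mono fun x hx => not_congr hx
  have := hs.subset_left_of_subset_union h1 h2
    (Set.disjoint_left.2 fun x hx hx' => hx'.2 hx.2)
    (fun x hx => (em (P x)).imp (fun h => ⟨hx, h⟩) fun h => ⟨hx, h⟩) ⟨a, ha, ha, hPa⟩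
  exact fun t ht => (this ht).2

theorem DepartsWith.unique {t : ℝ} {w w' : Plane} (h : DepartsWith α t w)
    (h' : DepartsWith α t w') : w = w' := by
  obtain ⟨ε, hε, h⟩ := h
  obtain ⟨δ, hδ, h'⟩ := h'
  have hm : 0 < min ε δ := lt_min hε hδ
  have h1 := h (min ε δ) ⟨hm.le, min_le_left _ _⟩
  rw [h' (min ε δ) ⟨hm.le, min_le_right _ _⟩] at h1
  exact (smul_right_injective _ hm.ne' (add_left_cancel h1)).symm

theorem ArrivesWith.unique {t : ℝ} {w w' : Plane} (h : ArrivesWith α t w)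
    (h' : ArrivesWith α t w') : w = w' := by
  obtain ⟨ε, hε, h⟩ := h
  obtain ⟨δ, hδ, h'⟩ := h'
  have hm : 0 < min ε δ := lt_min hε hδ
  have h1 := h (min ε δ) ⟨hm.le, min_le_left _ _⟩
  rw [h' (min ε δ) ⟨hm.le, min_le_right _ _⟩] at h1
  exact (smul_right_injective _ hm.ne' (sub_right_injective h1)).symm

theorem DepartsWith.exists_forall {t : ℝ} {w : Plane} (h : DepartsWith α t w) :
    ∃ ε > 0, ∀ h, 0 ≤ h → h < ε → α (t + h) = α t + h • w ∧ DepartsWith α (t + h) w := by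
  obtain ⟨ε, hε, h⟩ := h
  refine ⟨ε, hε, fun c hc hcε => ⟨h c ⟨hc, hcε.le⟩, ε - c, sub_pos.2 hcε, fun d hd => ?_⟩⟩
  rw [add_assoc, h _ ⟨add_nonneg hc hd.1, by linarith [hd.2]⟩, h c ⟨hc, hcε.le⟩]
  module

/-- Here `h` is strictly positive: at the time `t` itself the ball may bounce and depart with
another velocity. -/
theorem ArrivesWith.exists_forall {t : ℝ} {u : Plane} (h : ArrivesWith α t u) :
    ∃ ε > 0, ∀ h, 0 < h → h < ε → α (t - h) = α t - h • u ∧ DepartsWith α (t - h) u := by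
  obtain ⟨ε, hε, h⟩ := h
  refine ⟨ε, hε, fun c hc hcε => ⟨h c ⟨hc.le, hcε.le⟩, c, hc, fun d hd => ?_⟩⟩
  have e : t - c + d = t - (c - d) := by ring
  rw [e, h _ ⟨by linarith [hd.2], by linarith [hd.1]⟩, h c ⟨hc.le, hcε.le⟩]
  module

theorem IsNonsingularTrajectory.exists_departsWith (hα : IsNonsingularTrajectory T α) (t : ℝ) :
    ∃ w, DepartsWith α t w := by
  obtain ⟨c, -, h⟩ := hα.motion
  obtain ⟨u, w, -, -, -, h, -⟩ := h t
  exact ⟨w, h⟩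

theorem IsNonsingularTrajectory.exists_arrivesWith (hα : IsNonsingularTrajectory T α) (t : ℝ) :
    ∃ w, ArrivesWith α t w := by
  obtain ⟨c, -, h⟩ := hα.motion
  obtain ⟨u, w, -, -, h, -, -⟩ := h t
  exact ⟨u, h⟩

theorem IsNonsingularTrajectory.tri (hα : IsNonsingularTrajectory T α) (t : ℝ) :
    Tri (co T (α t)) :=
  (mem_closedInterior_iff T _).1 (hα.mem_table t)

theorem IsNonsingularTrajectory.mem_side_iff (hα : IsNonsingularTrajectory T α) (t : ℝ)
    (i : Fin 3) : α t ∈ side T i ↔ bary i (co T (α t)) = 0 := by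
  rw [Billiard.mem_side_iff]
  exact and_iff_right (hα.tri t)

theorem IsNonsingularTrajectory.not_isLat (hα : IsNonsingularTrajectory T α) (t : ℝ) :
    ¬ IsLat (co T (α t)) := by
  intro h
  obtain ⟨i, hi⟩ := (hα.tri t).exists_of_isLat h
  exact hα.ne_vertex t i ((eq_points_iff T _ _).2 hi)

theorem DepartsWith.ne_zero (hα : IsNonsingularTrajectory T α) {t : ℝ} {w : Plane}
    (hw : DepartsWith α t w) : cv T w ≠ 0 := by
  obtain ⟨c, hc, h⟩ := hα.motion
  obtain ⟨u, w', -, h1, -, h2, -⟩ := h t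
  obtain rfl := hw.unique h2
  intro h0
  have : w = 0 := cv_injective T (h0.trans (by simp [cv]))
  rw [this, norm_zero] at h1
  exact hc.ne h1

theorem IsNonsingularTrajectory.eq_reflection (hα : IsNonsingularTrajectory T α) {t : ℝ}
    {u w : Plane} (hu : ArrivesWith α t u) (hw : DepartsWith α t w) :
    ((∀ i, α t ∉ side T i) → w = u) ∧
    (∀ i, α t ∈ side T i → w = (sideLine T i).direction.reflection u) := by
  obtain ⟨c, hc, h⟩ := hα.motion
  obtain ⟨u', w', -, -, h1, h2, h3⟩ := h t
  obtain rfl := hw.unique h2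
  obtain rfl := hu.unique h1
  exact h3

theorem IsNonsingularTrajectory.rel_bounce (hT : T.Equilateral)
    (hα : IsNonsingularTrajectory T α) {t : ℝ}
    {u w : Plane} (hu : ArrivesWith α t u) (hw : DepartsWith α t w) :
    Rel (co T (α t)) (cv T u) (co T (α t)) (cv T w) := by
  obtain ⟨h1, h2⟩ := hα.eq_reflection hu hw
  by_cases h : ∃ i, α t ∈ side T i
  · obtain ⟨i, hi⟩ := h
    rw [h2 i hi, cv_reflection hT]
    exact rel_refl_of_bary_eq_zero ((hα.mem_side_iff t i).1 hi) _
  · rw [h1 (not_exists.1 h)]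
    exact Rel.refl _ _

theorem IsNonsingularTrajectory.eventually_rel (hT : T.Equilateral)
    (hα : IsNonsingularTrajectory T α) {a : ℝ} {w : Plane} (hw : DepartsWith α a w) :
    ∀ᶠ t in nhds a, ∀ u, DepartsWith α t u →
      Rel (co T (α a) + (t - a) • cv T w) (cv T w) (co T (α t)) (cv T u) := by
  obtain ⟨u, hu⟩ := hα.exists_arrivesWith a
  obtain ⟨ε, hε, h1⟩ := hw.exists_forall
  obtain ⟨δ, hδ, h2⟩ := hu.exists_forall
  filter_upwards [Ioo_mem_nhds (sub_lt_self a hδ) (lt_add_of_pos_right a hε)] with t ht x hx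
  rcases le_or_gt a t with hat | hat
  · obtain ⟨e1, e2⟩ := h1 (t - a) (sub_nonneg.2 hat) (by linarith [ht.2])
    rw [add_sub_cancel] at e1 e2
    rw [e1, co_add_smul, hx.unique e2]
    exact Rel.refl _ _
  · obtain ⟨e1, e2⟩ := h2 (a - t) (sub_pos.2 hat) (by linarith [ht.1])
    rw [sub_sub_cancel] at e1 e2
    rw [e1, co_sub_smul, hx.unique e2, neg_sub]
    -- Before the time `a` the ball moves with the arrival velocity, which the bounce relates to `w`
    -- at the same point.
    exact (hα.rel_bounce hT hu hw).symm.add_smul _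

/-- A trajectory is obtained from a straight line by elements of the group generated by the
reflections in the sides. -/
theorem IsNonsingularTrajectory.rel_line (hT : T.Equilateral)
    (hα : IsNonsingularTrajectory T α) {a : ℝ} {w : Plane} (hw : DepartsWith α a w)
    (t : ℝ) {u : Plane} (hu : DepartsWith α t u) :
    Rel (co T (α a) + (t - a) • cv T w) (cv T w) (co T (α t)) (cv T u) := by
  refine forall_mem_of_locally (P := fun t => ∀ u, DepartsWith α t u →
    Rel (co T (α a) + (t - a) • cv T w) (cv T w) (co T (α t)) (cv T u)) isPreconnected_univ
    isOpen_univ ?_ (Set.mem_univ a) ?_ t (Set.mem_univ t) u hu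
  · intro t _
    obtain ⟨u, hu⟩ := hα.exists_departsWith t
    filter_upwards [hα.eventually_rel hT hu] with s hs
    constructor
    · intro h u' hu'
      obtain rfl := hu.unique hu'
      obtain ⟨x, hx⟩ := hα.exists_departsWith s
      have h1 := (h x hx).trans (hs x hx).symm
      have h2 := h1.add_smul (t - s)
      have e1 : co T (α a) + (s - a) • cv T w + (t - s) • cv T w =
        co T (α a) + (t - a) • cv T w := by module
      have e2 : co T (α t) + (s - t) • cv T u + (t - s) • cv T u = co T (α t) := by module
      rwa [e1, e2] at h2
    · intro h x hx
      have h2 := (h u hu).add_smul (s - t)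
      have e1 : co T (α a) + (t - a) • cv T w + (s - t) • cv T w =
        co T (α a) + (s - a) • cv T w := by module
      rw [e1] at h2
      exact h2.trans (hs x hx)
  · intro u hu
    rw [hu.unique hw, sub_self, zero_smul, add_zero]
    exact Rel.refl _ _

theorem IsNonsingularTrajectory.rel_line_point (hT : T.Equilateral)
    (hα : IsNonsingularTrajectory T α) {a : ℝ} {w : Plane} (hw : DepartsWith α a w) (t : ℝ) :
    Rel (co T (α a) + (t - a) • cv T w) 0 (co T (α t)) 0 := by
  obtain ⟨u, hu⟩ := hα.exists_departsWith t
  exact (hα.rel_line hT hw t hu).point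

theorem IsNonsingularTrajectory.line_not_isLat (hT : T.Equilateral)
    (hα : IsNonsingularTrajectory T α) {a : ℝ} {w : Plane} (hw : DepartsWith α a w) (c : ℝ) :
    ¬ IsLat (co T (α a) + c • cv T w) := by
  intro h
  have h1 := hα.rel_line_point hT hw (a + c)
  rw [add_sub_cancel_left] at h1
  exact hα.not_isLat _ (h1.isLat h)

/-- The strikes are the crossings of lines of the tessellation. -/
theorem IsNonsingularTrajectory.strike_iff (hT : T.Equilateral)
    (hα : IsNonsingularTrajectory T α) {a : ℝ} {w : Plane} (hw : DepartsWith α a w) (t : ℝ) :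
    (∃ i, α t ∈ side T i) ↔ OnGrid (co T (α a) + (t - a) • cv T w) := by
  have h := hα.rel_line_point hT hw t
  simp only [hα.mem_side_iff]
  constructor
  · rintro ⟨i, hi⟩
    exact h.symm.onGrid (onGrid_of_bary_eq_zero hi)
  · intro hg
    obtain ⟨j, n, hn⟩ := h.onGrid hg
    obtain ⟨i, hi, -⟩ := (hα.tri t).exists_bary_eq_zero (hα.not_isLat t) hn
    exact ⟨i, hi⟩

/-- A line contained in a line of the tessellation would meet a vertex. -/
theorem IsNonsingularTrajectory.line_fam (hT : T.Equilateral)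
    (hα : IsNonsingularTrajectory T α) {a : ℝ} {w : Plane} (hw : DepartsWith α a w) (j : Fin 3)
    (h : fam j (cv T w) = 0) (n : ℤ) : fam j (co T (α a)) ≠ n := by
  intro hn
  obtain ⟨c, hc⟩ := exists_isLat_of_fam (hw.ne_zero hα) hn h
  exact hα.line_not_isLat hT hw c hc

/-- Remaining in the table gives the weak inequality; equality would make the ball run along the
side and into a vertex. -/
theorem DepartsWith.dbary_pos (hT : T.Equilateral)
    (hα : IsNonsingularTrajectory T α) {t : ℝ} {w : Plane} (hw : DepartsWith α t w) {i : Fin 3}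
    (hi : bary i (co T (α t)) = 0) : 0 < dbary i (cv T w) := by
  obtain ⟨ε, hε, h⟩ := hw.exists_forall
  have h1 := hα.tri (t + ε / 2) i
  rw [(h (ε / 2) (by linarith) (by linarith)).1, co_add_smul, bary_add_smul, hi, zero_add] at h1
  refine lt_of_le_of_ne (nonneg_of_mul_nonneg_right h1 (by linarith)) fun h0 => ?_
  obtain ⟨j, n, hn⟩ := onGrid_of_bary_eq_zero hi
  obtain ⟨i', hi', hj⟩ := (hα.tri t).exists_bary_eq_zero (hα.not_isLat t) hn
  obtain rfl : i = i' := by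
    by_contra hne
    exact hα.not_isLat t (isLat_of_two_bary_eq_zero hne hi hi')
  have h2 := hj (cv T w)
  rw [← h0, abs_zero] at h2
  exact hα.line_fam hT hw j (abs_eq_zero.1 h2.symm) n hn

/-- Between two strikes the ball moves along a straight line. -/
theorem IsNonsingularTrajectory.flight (hα : IsNonsingularTrajectory T α) {a b : ℝ} {w : Plane}
    (hab : a < b) (hw : DepartsWith α a w) (hs : ∀ t ∈ Set.Ioo a b, ∀ i, α t ∉ side T i) :
    α b = α a + (b - a) • w ∧ ArrivesWith α b w := by
  obtain ⟨ε, hε, h1⟩ := hw.exists_forall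
  have hm : 0 < min ε (b - a) := lt_min hε (sub_pos.2 hab)
  -- Away from the sides arrival and departure velocities agree, so the formula propagates locally;
  -- it is started just after `a`.
  have key : ∀ t ∈ Set.Ioo a b, α t = α a + (t - a) • w ∧ DepartsWith α t w := by
    refine forall_mem_of_locally isPreconnected_Ioo isOpen_Ioo ?_
      (a := a + min ε (b - a) / 2) ⟨by linarith, by linarith [min_le_right ε (b - a)]⟩ ?_
    · intro t ht
      obtain ⟨u, hu⟩ := hα.exists_departsWith t
      obtain ⟨x, hx⟩ := hα.exists_arrivesWith t
      obtain rfl := (hα.eq_reflection hx hu).1 (hs t ht)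
      obtain ⟨ε, hε, h1⟩ := hu.exists_forall
      obtain ⟨δ, hδ, h2⟩ := hx.exists_forall
      filter_upwards [Ioo_mem_nhds (sub_lt_self t hδ) (lt_add_of_pos_right t hε)] with s hsm
      have hs' : α s = α t + (s - t) • u ∧ DepartsWith α s u := by
        rcases le_or_gt t s with hts | hts
        · have := h1 (s - t) (sub_nonneg.2 hts) (by linarith [hsm.2])
          rwa [add_sub_cancel] at this
        · obtain ⟨e1, e2⟩ := h2 (t - s) (sub_pos.2 hts) (by linarith [hsm.1])
          rw [sub_sub_cancel] at e1 e2
          refine ⟨?_, e2⟩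
          rw [e1]; module
      constructor
      · rintro ⟨e1, e2⟩
        obtain rfl := hs'.2.unique e2
        refine ⟨?_, hu⟩
        have e3 := hs'.1.symm.trans e1
        rw [← sub_eq_zero] at e3 ⊢
        rw [← e3]; module
      · rintro ⟨e1, e2⟩
        obtain rfl := hu.unique e2
        refine ⟨?_, hs'.2⟩
        rw [hs'.1, e1]; module
    · obtain ⟨e1, e2⟩ := h1 (min ε (b - a) / 2) (by linarith) (by linarith [min_le_left ε (b - a)])
      refine ⟨?_, e2⟩
      rw [e1, add_sub_cancel_left]
  obtain ⟨u, hu⟩ := hα.exists_arrivesWith b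
  obtain ⟨δ, hδ, h2⟩ := hu.exists_forall
  have hm' : 0 < min δ (b - a) := lt_min hδ (sub_pos.2 hab)
  obtain ⟨e1, e2⟩ := h2 (min δ (b - a) / 2) (by linarith) (by linarith [min_le_left δ (b - a)])
  obtain ⟨e3, e4⟩ := key (b - min δ (b - a) / 2)
    ⟨by linarith [min_le_right δ (b - a)], by linarith⟩
  obtain rfl := e2.unique e4
  refine ⟨?_, hu⟩
  rw [e1, sub_eq_iff_eq_add] at e3
  rw [e3]; module

end Line

/-! ### Straight lines fold to trajectories -/

theorem dbary_neg (i : Fin 3) (v : ℝ × ℝ) : dbary i (-v) = -dbary i v := by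
  fin_cases i <;> simp [dbary]; ring

/-- Coordinates that vanish at `q` increase, and those that are positive stay so for a short time.
-/
theorem Tri.exists_forall_add_smul {q v : ℝ × ℝ} (hq : Tri q)
    (hv : ∀ i, bary i q = 0 → 0 < dbary i v) :
    ∃ ε > 0, ∀ h ∈ Set.Icc (0 : ℝ) ε, Tri (q + h • v) := by
  have key : ∀ i, ∀ᶠ h in nhdsWithin (0 : ℝ) (Set.Ici 0), 0 ≤ bary i (q + h • v) := by
    intro i
    simp only [bary_add_smul]
    rcases (hq i).eq_or_lt with h0 | h0
    · filter_upwards [self_mem_nhdsWithin] with h hh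
      rw [← h0, zero_add]
      exact mul_nonneg hh (hv i h0.symm).le
    · refine nhdsWithin_le_nhds ?_
      have hc : Continuous fun h : ℝ => bary i q + h * dbary i v := by fun_prop
      have := hc.tendsto 0
      rw [zero_mul, add_zero] at this
      exact (this.eventually_const_lt h0).mono fun _ h => h.le
  have hall := Filter.eventually_all.2 key
  obtain ⟨ε, hε, h⟩ := mem_nhdsGE_iff_exists_Icc_subset.1 hall
  exact ⟨ε, hε, fun c hc => h hc⟩

/-- The point of the table in the orbit of `p`. -/
def fold (p : ℝ × ℝ) : ℝ × ℝ := (exists_rel_tri p 0).choose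

theorem rel_fold (p : ℝ × ℝ) : Rel p 0 (fold p) 0 := by
  obtain ⟨w, h, -⟩ := (exists_rel_tri p 0).choose_spec
  exact h.point

theorem tri_fold (p : ℝ × ℝ) : Tri (fold p) := by
  obtain ⟨w, -, h⟩ := (exists_rel_tri p 0).choose_spec
  exact h

theorem Rel.fold_eq {p v q w : ℝ × ℝ} (h : Rel p v q w) (hq : Tri q) : fold p = q :=
  ((rel_fold p).symm.trans h.point).eq_of_tri (tri_fold p) hq

variable (T) in
/-- The curve in the table obtained by folding a straight line. -/
def foldedLine (p v : ℝ × ℝ) (t : ℝ) : Plane := pt T (fold (p + t • v))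

/-- The group element that folds the line at time `t` keeps folding it as long as the image stays in
the table. -/
theorem foldedLine_departsWith {p v q x : ℝ × ℝ} {t : ℝ} (hr : Rel (p + t • v) v q x)
    (hq : Tri q) (h : ∀ i, bary i q = 0 → 0 < dbary i x) :
    DepartsWith (foldedLine T p v) t (frame T x) := by
  obtain ⟨ε, hε, he⟩ := hq.exists_forall_add_smul h
  refine ⟨ε, hε, fun c hc => ?_⟩
  have e : p + (t + c) • v = p + t • v + c • v := by module
  rw [foldedLine, foldedLine, hr.fold_eq hq, e, (hr.add_smul c).fold_eq (he c hc), pt_add_smul]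

theorem foldedLine_arrivesWith {p v q x : ℝ × ℝ} {t : ℝ} (hr : Rel (p + t • v) v q x)
    (hq : Tri q) (h : ∀ i, bary i q = 0 → dbary i x < 0) :
    ArrivesWith (foldedLine T p v) t (frame T x) := by
  obtain ⟨ε, hε, he⟩ := hq.exists_forall_add_smul (v := -x)
    fun i hi => by rw [dbary_neg]; exact neg_pos.2 (h i hi)
  refine ⟨ε, hε, fun c hc => ?_⟩
  have e : p + (t - c) • v = p + t • v + (-c) • v := by module
  have h1 := he c hc
  have e2 : q + c • -x = q + (-c) • x := by module
  rw [e2] at h1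
  rw [foldedLine, foldedLine, hr.fold_eq hq, e, (hr.add_smul (-c)).fold_eq h1, pt_add_smul]
  module

/-- A folded line crosses the sides transversally, since otherwise it would run along one into a
vertex. -/
theorem dbary_ne_zero_of_line {p v q x : ℝ × ℝ} (hv : v ≠ 0) (hl : ∀ c : ℝ, ¬ IsLat (p + c • v))
    {t : ℝ} (hr : Rel (p + t • v) v q x) (hq : Tri q) {i : Fin 3} (hi : bary i q = 0) :
    dbary i x ≠ 0 := by
  have hlq : ∀ c : ℝ, ¬ IsLat (q + c • x) := by
    intro c hc
    have := (hr.add_smul c).symm.isLat hc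
    rw [add_assoc, ← add_smul] at this
    exact hl _ this
  have hlq0 : ¬ IsLat q := by simpa using hlq 0
  intro h0
  obtain ⟨j, n, hn⟩ := onGrid_of_bary_eq_zero hi
  obtain ⟨i', hi', hj⟩ := hq.exists_bary_eq_zero hlq0 hn
  obtain rfl : i = i' := by
    by_contra hne
    exact hlq0 (isLat_of_two_bary_eq_zero hne hi hi')
  have h2 := hj x
  rw [h0, abs_zero] at h2
  have hx : x ≠ 0 := by
    intro hx
    have h3 := hr.normSq
    rw [hx] at h3
    have := normSq_pos hv
    rw [← h3] at this
    simp [normSq] at this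
  obtain ⟨c, hc⟩ := exists_isLat_of_fam hx hn (abs_eq_zero.1 h2.symm)
  exact hlq c hc

theorem foldedLine_isNonsingularTrajectory (hT : T.Equilateral) {p v : ℝ × ℝ} (hv : v ≠ 0)
    (hl : ∀ c : ℝ, ¬ IsLat (p + c • v)) : IsNonsingularTrajectory T (foldedLine T p v) := by
  have hnl : ∀ {t q x}, Rel (p + t • v) v q x → ¬ IsLat q := fun h hq =>
    hl _ (h.symm.isLat hq)
  refine ⟨fun t => ?_, fun t i h => ?_, ?_⟩
  · rw [mem_closedInterior_iff, foldedLine, co_pt]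
    exact tri_fold _
  · obtain ⟨q, x, hr, hq⟩ := exists_rel_tri (p + t • v) v
    have h1 := (eq_points_iff T _ _).1 h
    rw [foldedLine, co_pt, hr.fold_eq hq] at h1
    have hne1 : i + 1 ≠ i := by fin_cases i <;> simp
    have hne2 : i + 2 ≠ i := by fin_cases i <;> simp
    have hne : i + 1 ≠ i + 2 := by fin_cases i <;> simp
    refine hnl hr (isLat_of_two_bary_eq_zero hne ?_ ?_)
    · rw [h1, if_neg hne1]
    · rw [h1, if_neg hne2]
  · obtain ⟨s, hs, hnorm⟩ := norm_sq_eq hT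
    refine ⟨s * Real.sqrt (normSq v), mul_pos hs (Real.sqrt_pos.2 (normSq_pos hv)), fun t => ?_⟩
    obtain ⟨q, x, hr, hq⟩ := exists_rel_tri (p + t • v) v
    have hside : ∀ i, foldedLine T p v t ∈ side T i ↔ bary i q = 0 := by
      intro i
      rw [mem_side_iff, foldedLine, co_pt, hr.fold_eq hq]
      exact and_iff_right hq
    have hn : ∀ {y}, Rel (p + t • v) v q y →
        ‖frame T y‖ = s * Real.sqrt (normSq v) := fun h => by
      rw [hnorm, cv_frame, h.normSq]
    by_cases hb : ∃ i, bary i q = 0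
    · obtain ⟨i, hi⟩ := hb
      have huniq : ∀ j, bary j q = 0 → j = i := by
        intro j hj
        by_contra hne
        exact hnl hr (isLat_of_two_bary_eq_zero hne hj hi)
      have hr' := hr.trans (rel_refl_of_bary_eq_zero hi x)
      have hd : dbary i (refl i x) = -dbary i x := by rw [dbary_refl, if_pos rfl]
      -- At a strike the velocity `x` may point out of the table or into it. It is the velocity of
      -- arrival or of departure accordingly, and its reflection is the other.
      rcases (dbary_ne_zero_of_line hv hl hr hq hi).lt_or_gt with h0 | h0
      · refine ⟨frame T x, frame T (refl i x), hn hr, hn hr', foldedLine_arrivesWith hr hq ?_,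
          foldedLine_departsWith hr' hq ?_, fun h => absurd ((hside i).2 hi) (h i), fun j hj => ?_⟩
        · intro j hj; rwa [huniq j hj]
        · intro j hj; rw [huniq j hj, hd]; linarith
        · rw [huniq j ((hside j).1 hj)]
          apply cv_injective T
          rw [cv_reflection hT, cv_frame, cv_frame]
      · refine ⟨frame T (refl i x), frame T x, hn hr', hn hr, foldedLine_arrivesWith hr' hq ?_,
          foldedLine_departsWith hr hq ?_, fun h => absurd ((hside i).2 hi) (h i), fun j hj => ?_⟩
        · intro j hj; rw [huniq j hj, hd]; linarith
        · intro j hj; rwa [huniq j hj]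
        · rw [huniq j ((hside j).1 hj)]
          apply cv_injective T
          rw [cv_reflection hT, cv_frame, cv_frame, refl_refl]
    · rw [not_exists] at hb
      exact ⟨frame T x, frame T x, hn hr, hn hr,
        foldedLine_arrivesWith hr hq fun i hi => absurd hi (hb i),
        foldedLine_departsWith hr hq fun i hi => absurd hi (hb i), fun _ => rfl,
        fun i hi => absurd ((hside i).1 hi) (hb i)⟩

variable (T) in
/-- The periodic orbit obtained by folding a segment from `p` to `p + v`, where `v` is a
translation in the group generated by the reflections in the sides. -/
def foldedCurve (hT : T.Equilateral) (p : ℝ × ℝ) {k l : ℤ} (hkl : 3 ∣ k - l)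
    (hv : ((k : ℝ), (l : ℝ)) ≠ 0) (hl : ∀ c : ℝ, ¬ IsLat (p + c • ((k : ℝ), (l : ℝ)))) :
    PeriodicCurve T where
  toFun := foldedLine T p (k, l)
  a := 0
  b := 1
  a_lt_b := zero_lt_one
  nonsingular := foldedLine_isNonsingularTrajectory hT hv hl
  periodic t := by
    have e : p + (1 + t) • ((k : ℝ), (l : ℝ)) = p + t • ((k : ℝ), (l : ℝ)) + ((k : ℝ), (l : ℝ)) := by
      module
    rw [zero_add, foldedLine, foldedLine, e]
    congr 1
    exact ((rel_add_int _ 0 hkl).trans (rel_fold _)).fold_eq (tri_fold _)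

/-! ### Counting strikes -/

/-- The crossings correspond to the integers in `[c, c + K)`. Finiteness is recorded as well,
because `ncard` is `0` on infinite sets. -/
theorem finite_ncard_crossings_of_pos {a b c m : ℝ} (hab : a < b) {K : ℤ} (hK : m * (b - a) = K)
    (hm : 0 < m) : {t | t ∈ Set.Ico a b ∧ ∃ n : ℤ, c + (t - a) * m = n}.Finite ∧
      {t | t ∈ Set.Ico a b ∧ ∃ n : ℤ, c + (t - a) * m = n}.ncard = K.natAbs := by
  have e : {t | t ∈ Set.Ico a b ∧ ∃ n : ℤ, c + (t - a) * m = n} =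
      (fun n : ℤ => a + (n - c) / m) '' (Finset.Ico ⌈c⌉ (⌈c⌉ + K) : Finset ℤ) := by
    ext t
    simp only [Set.mem_ofPred_eq, Set.mem_Ico, Finset.coe_Ico, Set.mem_image]
    constructor
    · rintro ⟨⟨h1, h2⟩, n, hn⟩
      refine ⟨n, ⟨Int.ceil_le.2 ?_, ?_⟩, ?_⟩
      · nlinarith
      · have : (n : ℝ) < c + K := by rw [← hK, ← hn]; nlinarith
        have h3 := Int.le_ceil c
        have : (n : ℝ) < ((⌈c⌉ + K : ℤ) : ℝ) := by push_cast; linarith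
        exact_mod_cast this
      · rw [← hn]; field_simp; ring
    · rintro ⟨n, ⟨h1, h2⟩, rfl⟩
      have h1' := Int.ceil_le.1 h1
      have h2' : (n : ℝ) < c + K := by
        have h3 : n - K < ⌈c⌉ := by omega
        have h4 := Int.lt_ceil.1 h3
        push_cast at h4
        linarith
      refine ⟨⟨?_, ?_⟩, n, ?_⟩
      · have := div_nonneg (sub_nonneg.2 h1') hm.le
        linarith
      · have : (n - c) / m < b - a := by rw [div_lt_iff₀ hm]; linarith
        linarith
      · field_simp; ring
  have hinj : Function.Injective fun n : ℤ => a + ((n : ℝ) - c) / m := by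
    intro x y hxy
    simp only [add_right_inj] at hxy
    rw [div_left_inj' hm.ne'] at hxy
    have : (x : ℝ) = y := by linarith
    exact_mod_cast this
  rw [e]
  refine ⟨(Finset.finite_toSet _).image _, ?_⟩
  rw [Set.ncard_image_of_injective _ hinj, Set.ncard_coe_finset, Int.card_Ico]
  have : 0 ≤ K := by
    have : (0 : ℝ) ≤ K := by rw [← hK]; nlinarith
    exact_mod_cast this
  omega

theorem finite_ncard_crossings {a b c m : ℝ} (hab : a < b) {K : ℤ} (hK : m * (b - a) = K)
    (h0 : m = 0 → ∀ n : ℤ, c ≠ n) : {t | t ∈ Set.Ico a b ∧ ∃ n : ℤ, c + (t - a) * m = n}.Finite ∧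
      {t | t ∈ Set.Ico a b ∧ ∃ n : ℤ, c + (t - a) * m = n}.ncard = K.natAbs := by
  rcases lt_trichotomy m 0 with hm | hm | hm
  · have h := finite_ncard_crossings_of_pos (c := -c) (m := -m) (K := -K) hab
      (by push_cast; linarith) (by linarith)
    have e : {t | t ∈ Set.Ico a b ∧ ∃ n : ℤ, c + (t - a) * m = n} =
        {t | t ∈ Set.Ico a b ∧ ∃ n : ℤ, -c + (t - a) * -m = n} := by
      ext t
      refine and_congr Iff.rfl ⟨?_, ?_⟩
      · rintro ⟨n, hn⟩; exact ⟨-n, by push_cast; linarith⟩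
      · rintro ⟨n, hn⟩; exact ⟨-n, by push_cast; linarith⟩
    rw [e]
    rwa [Int.natAbs_neg] at h
  · have e : {t | t ∈ Set.Ico a b ∧ ∃ n : ℤ, c + (t - a) * m = n} = ∅ := by
      rw [Set.eq_empty_iff_forall_notMem]
      rintro t ⟨-, n, hn⟩
      rw [hm, mul_zero, add_zero] at hn
      exact h0 hm n hn
    rw [e]
    have : K = 0 := by
      have : (K : ℝ) = 0 := by rw [← hK, hm, zero_mul]
      exact_mod_cast this
    simp [this]
  · exact finite_ncard_crossings_of_pos hab hK hm

theorem isLat_of_two_fam {p : ℝ × ℝ} {i j : Fin 3} (hij : i ≠ j) {m n : ℤ} (hi : fam i p = m)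
    (hj : fam j p = n) : IsLat p := by
  obtain ⟨x, y⟩ := p
  fin_cases i <;> fin_cases j <;> simp [fam] at hi hj hij
  · exact ⟨m, n, by rw [hi, hj]⟩
  · exact ⟨m, n - m, by push_cast; rw [← hj, hi]; simp⟩
  · exact ⟨n, m, by rw [hi, hj]⟩
  · exact ⟨n - m, m, by push_cast; rw [← hj, hi]; simp⟩
  · exact ⟨n, m - n, by push_cast; rw [← hi, hj]; simp⟩
  · exact ⟨m - n, n, by push_cast; rw [← hi, hj]; simp⟩

theorem PeriodicCurve.strikes_eq (hT : T.Equilateral) (α : PeriodicCurve T) {w : Plane}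
    (hw : DepartsWith α.toFun α.a w) : α.strikes =
      {t | OnGrid (co T (α.toFun α.a) + (t - α.a) • cv T w)} := by
  ext t
  exact α.nonsingular.strike_iff hT hw t

theorem PeriodicCurve.apply_b (α : PeriodicCurve T) : α.toFun α.b = α.toFun α.a := by
  simpa using (α.periodic 0).symm

theorem PeriodicCurve.departsWith_b (α : PeriodicCurve T) {w : Plane}
    (hw : DepartsWith α.toFun α.a w) : DepartsWith α.toFun α.b w := by
  obtain ⟨ε, hε, h⟩ := hw
  refine ⟨ε, hε, fun c hc => ?_⟩
  rw [← α.periodic, h c hc, α.apply_b]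

/-- The three terms count the crossings of the three families of parallels. No crossing is counted
twice, since two families meet only in vertices. -/
theorem PeriodicCurve.finite_period_of_translation (hT : T.Equilateral) (α : PeriodicCurve T)
    {w : Plane} (hw : DepartsWith α.toFun α.a w) {k l : ℤ}
    (hkl : (α.b - α.a) • cv T w = ((k : ℝ), (l : ℝ))) :
    (Set.Ico α.a α.b ∩ α.strikes).Finite ∧
      α.period = k.natAbs + l.natAbs + (k + l).natAbs := by
  set p := co T (α.toFun α.a) with hp
  set v := cv T w with hv
  let S : Fin 3 → Set ℝ := fun j =>
    {t | t ∈ Set.Ico α.a α.b ∧ ∃ n : ℤ, fam j p + (t - α.a) * fam j v = n}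
  have hS : Set.Ico α.a α.b ∩ α.strikes = S 0 ∪ S 1 ∪ S 2 := by
    rw [α.strikes_eq hT hw]
    ext t
    simp only [OnGrid, fam_add_smul, Set.mem_inter_iff, Set.mem_ofPred_eq, Set.mem_union, S,
      Fin.exists_fin_succ, ← hp, ← hv]
    simp
    tauto
  have hfam : ∀ j, fam j v * (α.b - α.a) = ![k, l, k + l] j := by
    intro j
    have h1 : v.1 * (α.b - α.a) = k := by
      have := congrArg Prod.fst hkl
      simp at this; linarith
    have h2 : v.2 * (α.b - α.a) = l := by
      have := congrArg Prod.snd hkl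
      simp at this; linarith
    fin_cases j <;> simp [fam, h1, h2]
    linarith
  have hc := fun j => finite_ncard_crossings α.a_lt_b (c := fam j p) (hfam j)
    fun h n => α.nonsingular.line_fam hT hw j h n
  have hd : ∀ i j, i ≠ j → Disjoint (S i) (S j) := by
    intro i j hij
    rw [Set.disjoint_left]
    rintro t ⟨-, m, hm⟩ ⟨-, n, hn⟩
    rw [← fam_add_smul] at hm hn
    exact α.nonsingular.line_not_isLat hT hw _ (isLat_of_two_fam hij hm hn)
  have h0 := hc 0
  have h1 := hc 1
  have h2 := hc 2
  rw [PeriodicCurve.period, hS]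
  refine ⟨(h0.1.union h1.1).union h2.1, ?_⟩
  rw [Set.ncard_union_eq ?_ (h0.1.union h1.1) h2.1, Set.ncard_union_eq (hd 0 1 (by decide)) h0.1 h1.1,
    h0.2, h1.2, h2.2]
  · rfl
  · exact Set.disjoint_union_left.2 ⟨hd 0 2 (by decide), hd 1 2 (by decide)⟩

/-! ### The orbit of Fagnano -/

theorem co_midpoint (i : Fin 3) : co T (midpoint ℝ (T.points (i + 1)) (T.points (i + 2))) =
    ![(1 / 2, 0), (1 / 2, 1 / 2), (0, 1 / 2)] i := by
  have h : midpoint ℝ (T.points (i + 1)) (T.points (i + 2)) =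
      pt T (![(1 / 2, 0), (1 / 2, 1 / 2), (0, 1 / 2)] i) := by
    rw [pt_eq_sum, Fin.sum_univ_three, midpoint_eq_smul_add]
    fin_cases i <;> simp [bary] <;> module
  rw [h, co_pt]

theorem co_lineMap (p q : Plane) (f : ℝ) :
    co T (AffineMap.lineMap p q f) = co T p + f • (co T q - co T p) := by
  rw [AffineMap.lineMap_apply, vsub_eq_sub, vadd_eq_add, add_comm, co_add_smul,
    cv_sub_eq_co_sub]

/-- The vertical line through the midpoint of `BC` folds to Fagnano's orbit. -/
theorem rel_fagnano (τ : ℝ) : Rel (1 / 2, τ / 2) 0 (co T (fagnano T τ)) 0 ∧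
    Tri (co T (fagnano T τ)) := by
  rw [fagnano, co_lineMap]
  have hf0 := Int.fract_nonneg τ
  have hf1 := (Int.fract_lt_one τ).le
  have hτ : τ = ⌊τ⌋ + Int.fract τ := (Int.floor_add_fract τ).symm
  generalize Int.fract τ = f at *
  generalize ⌊τ⌋ = n at *
  subst hτ
  -- The midpoints recur modulo 3, but the third step is a glide reflection; the translation `(0,
  -- 3)` is reached after six, so each residue modulo 6 has its own folding element.
  obtain ⟨q, r, hr, hn⟩ : ∃ q r : ℤ,
      (r = 0 ∨ r = 1 ∨ r = 2 ∨ r = 3 ∨ r = 4 ∨ r = 5) ∧ n = 6 * q + r :=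
    ⟨n / 6, n % 6, by omega, by omega⟩
  have hmid : ∀ (j : ℤ) (i : Fin 3), ((j : ZMod 3) : Fin 3) = i →
      co T (sideMidpoint T j) = ![(1 / 2, 0), (1 / 2, 1 / 2), (0, 1 / 2)] i := by
    rintro j i rfl
    exact co_midpoint _
  have h3 : (6 : ZMod 3) = 0 := rfl
  subst hn
  rcases hr with rfl | rfl | rfl | rfl | rfl | rfl
  · rw [hmid (6 * q + 0) 0 (by push_cast; rw [h3]; ring_nf; rfl),
      hmid (6 * q + 0 + 1) 1 (by push_cast; rw [h3]; ring_nf; rfl), tri_iff]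
    refine ⟨⟨0, 0, -3 * q, by omega, ?_, ?_⟩, ?_⟩
    · ext <;> simp [pointGroup] <;> ring
    · exact (pointGroup_zero _).symm
    · simp; refine ⟨?_, ?_⟩ <;> linarith
  · rw [hmid (6 * q + 1) 1 (by push_cast; rw [h3]; ring_nf; rfl),
      hmid (6 * q + 1 + 1) 2 (by push_cast; rw [h3]; ring_nf; rfl), tri_iff]
    refine ⟨⟨4, 1 + 3 * q, 1, by omega, ?_, ?_⟩, ?_⟩
    · ext <;> simp [pointGroup] <;> ring
    · exact (pointGroup_zero _).symm
    · simp; refine ⟨?_, ?_⟩ <;> linarith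
  · rw [hmid (6 * q + 2) 2 (by push_cast; rw [h3]; ring_nf; rfl),
      hmid (6 * q + 2 + 1) 0 (by push_cast; rw [h3]; ring_nf; rfl), tri_iff]
    refine ⟨⟨2, -3 * q - 1, 2 + 3 * q, by omega, ?_, ?_⟩, ?_⟩
    · ext <;> simp [pointGroup] <;> ring
    · exact (pointGroup_zero _).symm
    · simp; refine ⟨?_, ?_, ?_⟩ <;> linarith
  · rw [hmid (6 * q + 3) 0 (by push_cast; rw [h3]; ring_nf; rfl),
      hmid (6 * q + 3 + 1) 1 (by push_cast; rw [h3]; ring_nf; rfl), tri_iff]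
    refine ⟨⟨5, 1, -2 - 3 * q, by omega, ?_, ?_⟩, ?_⟩
    · ext <;> simp [pointGroup] <;> ring
    · exact (pointGroup_zero _).symm
    · simp; refine ⟨?_, ?_⟩ <;> linarith
  · rw [hmid (6 * q + 4) 1 (by push_cast; rw [h3]; ring_nf; rfl),
      hmid (6 * q + 4 + 1) 2 (by push_cast; rw [h3]; ring_nf; rfl), tri_iff]
    refine ⟨⟨1, 3 + 3 * q, 0, by omega, ?_, ?_⟩, ?_⟩
    · ext <;> simp [pointGroup] <;> ring
    · exact (pointGroup_zero _).symm
    · simp; refine ⟨?_, ?_⟩ <;> linarith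
  · rw [hmid (6 * q + 5) 2 (by push_cast; rw [h3]; ring_nf; rfl),
      hmid (6 * q + 5 + 1) 0 (by push_cast; rw [h3]; ring_nf; rfl), tri_iff]
    refine ⟨⟨3, -3 - 3 * q, 3 + 3 * q, by omega, ?_, ?_⟩, ?_⟩
    · ext <;> simp [pointGroup] <;> ring
    · exact (pointGroup_zero _).symm
    · simp; refine ⟨?_, ?_, ?_⟩ <;> linarith

theorem rel_half (n : ℤ) (y : ℝ) : Rel (n + 1 / 2, y) 0 (1 / 2, y - n) 0 :=
  ⟨0, -n, -n, by simp, by ext <;> simp [pointGroup]; ring, by simp [pointGroup]⟩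

/-- An element of the group that moves a line along itself is a translation, or the line carries
the orbit of Fagnano. -/
theorem translation_or_glide {p v : ℝ × ℝ} (hv : v ≠ 0) {c : ℝ}
    (hl : ∀ j, fam j v = 0 → ∀ n : ℤ, fam j p ≠ n) (h : Rel (p + c • v) v p v) :
    (∃ k l : ℤ, 3 ∣ k - l ∧ c • v = ((k : ℝ), (l : ℝ))) ∨
    ∃ (m s : ℝ) (J : ℤ), J % 2 = 1 ∧ m ≠ 0 ∧ m * c = 3 * J ∧
      ∀ t : ℝ, Rel (p + t • v) 0 (1 / 2, (m * t + s) / 2) 0 := by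
  obtain ⟨i, k, l, hd, h1, h2⟩ := h
  obtain ⟨x, y⟩ := p
  obtain ⟨a, b⟩ := v
  have habne : ¬ (a = 0 ∧ b = 0) := fun h => hv (Prod.ext h.1 h.2)
  have hl0 := hl 0
  have hl1 := hl 1
  have hl2 := hl 2
  simp [fam] at hl0 hl1 hl2
  fin_cases i <;> simp [pointGroup] at h1 h2
  · left
    refine ⟨-k, -l, by omega, ?_⟩
    ext <;> simp <;> linarith
  · exact absurd ⟨by linarith, by linarith⟩ habne
  · exact absurd ⟨by linarith, by linarith⟩ habne
  -- A linear part that is a reflection fixes `v` only along its mirror. The transverse coordinate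
  -- of the line is then half an integer, and that integer is odd because the line is no line of the
  -- tessellation; this also makes `J` odd.
  · right
    obtain rfl : b = 0 := by linarith
    have ha : a ≠ 0 := fun ha => habne ⟨ha, rfl⟩
    have hy : 2 * y = l := by linarith [h1.2]
    have hlo : l % 2 = 1 := by
      by_contra hlo
      obtain ⟨n, rfl⟩ : ∃ n, l = 2 * n := ⟨l / 2, by omega⟩
      push_cast at hy
      exact hl1 rfl n (by linarith)
    obtain ⟨n, rfl⟩ : ∃ n, l = 2 * n + 1 := ⟨l / 2, by omega⟩
    obtain ⟨J, hJ⟩ : ∃ J, (2 * n + 1) + 2 * k = 3 * J := ⟨((2 * n + 1) + 2 * k) / 3, by omega⟩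
    have hJ' : (2 * (n : ℝ) + 1) + 2 * k = 3 * J := by exact_mod_cast hJ
    push_cast at hy
    refine ⟨-2 * a, -2 * x - 2 * y - 2 * n, J, by omega, by simpa using ha, by linarith [h1.1],
      fun t => ?_⟩
    refine Rel.trans (q := (n + 1 / 2, -(x + t * a) - y)) (w := 0)
      ⟨2, 0, 0, by simp, ?_, (pointGroup_zero _).symm⟩ ?_
    · ext <;> simp [pointGroup]
      linarith
    · convert rel_half n (-(x + t * a) - y) using 2
      linarith
  · right
    obtain rfl : b = -a := by linarith
    have ha : a ≠ 0 := fun ha => habne ⟨ha, by simp [ha]⟩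
    have hy : 2 * (x + y) = k + l := by linarith [h1.1, h1.2]
    have hlo : (k + l) % 2 = 1 := by
      by_contra hlo
      obtain ⟨n, hn⟩ : ∃ n, k + l = 2 * n := ⟨(k + l) / 2, by omega⟩
      have hn' : (k : ℝ) + l = 2 * n := by exact_mod_cast hn
      exact hl2 (by ring) n (by linarith)
    obtain ⟨n, hn⟩ : ∃ n, -(k + l) = 2 * n + 1 := ⟨(-(k + l)) / 2, by omega⟩
    have hn' : -((k : ℝ) + l) = 2 * n + 1 := by exact_mod_cast hn
    obtain ⟨J, hJ⟩ : ∃ J, l - k = 3 * J := ⟨(l - k) / 3, by omega⟩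
    have hJ' : (l : ℝ) - k = 3 * J := by exact_mod_cast hJ
    refine ⟨2 * a, 2 * x - 2 * n, J, by omega, by simpa using ha, by linarith [h1.1, h1.2],
      fun t => ?_⟩
    refine Rel.trans (q := (n + 1 / 2, x + t * a)) (w := 0)
      ⟨1, 0, 0, by simp, ?_, (pointGroup_zero _).symm⟩ ?_
    · ext <;> simp [pointGroup]
      linarith
    · convert rel_half n (x + t * a) using 2
      linarith
  · right
    obtain rfl : a = 0 := by linarith
    have hb : b ≠ 0 := fun hb => habne ⟨rfl, hb⟩
    have hx : 2 * x = k := by linarith [h1.1]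
    have hko : k % 2 = 1 := by
      by_contra hko
      obtain ⟨n, rfl⟩ : ∃ n, k = 2 * n := ⟨k / 2, by omega⟩
      push_cast at hx
      exact hl0 rfl n (by linarith)
    obtain ⟨n, rfl⟩ : ∃ n, k = 2 * n + 1 := ⟨k / 2, by omega⟩
    obtain ⟨J, hJ⟩ : ∃ J, -((2 * n + 1) + 2 * l) = 3 * J := ⟨-((2 * n + 1) + 2 * l) / 3, by omega⟩
    have hJ' : -((2 * (n : ℝ) + 1) + 2 * l) = 3 * J := by exact_mod_cast hJ
    push_cast at hx
    refine ⟨2 * b, 2 * y - 2 * n, J, by omega, by simpa using hb, by linarith [h1.2],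
      fun t => ?_⟩
    have := rel_half n (y + t * b)
    convert this using 2
    · simp; linarith
    · simp
    · linarith

/-- A periodic orbit translates its unfolding, or is an odd iterate of Fagnano's orbit. -/
theorem PeriodicCurve.translation_or_fagnano (hT : T.Equilateral) (α : PeriodicCurve T)
    {w : Plane} (hw : DepartsWith α.toFun α.a w) :
    (Set.Ico α.a α.b ∩ α.strikes).Finite ∧
    ((∃ k l : ℤ, 3 ∣ k - l ∧ (α.b - α.a) • cv T w = ((k : ℝ), (l : ℝ)) ∧
      α.period = k.natAbs + l.natAbs + (k + l).natAbs) ∨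
    ∃ J : ℕ, J % 2 = 1 ∧ α.IsFagnanoIterate J ∧ α.period = 3 * J) := by
  have hr := α.nonsingular.rel_line hT hw α.b (α.departsWith_b hw)
  rw [α.apply_b] at hr
  rcases translation_or_glide (hw.ne_zero α.nonsingular)
    (fun j h n => α.nonsingular.line_fam hT hw j h n) hr with
    ⟨k, l, hkl, h⟩ | ⟨m, s, J, hJ, hm, hmJ, h⟩
  · have := α.finite_period_of_translation hT hw h
    exact ⟨this.1, Or.inl ⟨k, l, hkl, h, this.2⟩⟩
  · have hα : ∀ t, α.toFun t = fagnano T (m * t + (s - m * α.a)) := by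
      intro t
      apply co_injective T
      have h1 := h (t - α.a)
      have e : m * (t - α.a) + s = m * t + (s - m * α.a) := by ring
      rw [e] at h1
      have h2 := rel_fagnano (T := T) (m * t + (s - m * α.a))
      exact ((α.nonsingular.rel_line_point hT hw t).symm.trans (h1.trans h2.1)).eq_of_tri
        (α.nonsingular.tri t) h2.2
    have hS : Set.Ico α.a α.b ∩ α.strikes =
        {t | t ∈ Set.Ico α.a α.b ∧ ∃ n : ℤ, s + (t - α.a) * m = n} := by
      rw [α.strikes_eq hT hw]
      ext t
      refine and_congr Iff.rfl ?_
      have h1 := h (t - α.a)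
      constructor
      · intro hg
        obtain ⟨j, n, hn⟩ := h1.onGrid hg
        -- On the line `x = 1 / 2` the first family is never crossed, and the other two are crossed
        -- at even and odd values of the parameter respectively.
        fin_cases j <;> simp [fam] at hn
        · exfalso
          have h2 : (1 : ℝ) = 2 * n := by linarith
          have h3 : (1 : ℤ) = 2 * n := by exact_mod_cast h2
          omega
        · exact ⟨2 * n, by push_cast; linarith⟩
        · exact ⟨2 * n - 1, by push_cast; linarith⟩
      · rintro ⟨n, hn⟩
        refine h1.symm.onGrid ?_
        rcases Int.even_or_odd' n with ⟨i, rfl | rfl⟩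
        · exact ⟨1, i, by simp [fam]; push_cast at hn; linarith⟩
        · exact ⟨2, i + 1, by simp [fam]; push_cast at hn; linarith⟩
    have hc := finite_ncard_crossings (c := s) α.a_lt_b (K := 3 * J) (by push_cast; exact hmJ)
      fun h0 => absurd h0 hm
    rw [PeriodicCurve.period, hS]
    refine ⟨hc.1, Or.inr ⟨J.natAbs, by omega, ⟨m, s - m * α.a, hm, hα, ?_⟩, ?_⟩⟩
    · have hpos := sub_pos.2 α.a_lt_b
      have : |m| * (α.b - α.a) = |3 * (J : ℝ)| := by rw [← hmJ, abs_mul, abs_of_pos hpos]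
      rw [this, abs_mul, Nat.cast_natAbs]
      simp
    · rw [hc.2]; omega

/-! ### Unfoldings are straight segments -/

/-- Reflecting in the image of a side under an isometry is the conjugate of reflecting in the side.
The unfolding thus becomes a product of reflections in the fixed sides, with the newest applied
first. -/
theorem unfoldMap_succ (k : ℕ → Fin 3) (i : ℕ) (p : Plane) : unfoldMap T k (i + 1) p =
    unfoldMap T k i (EuclideanGeometry.reflection
      line[ℝ, T.points (k (i + 1) + 1), T.points (k (i + 1) + 2)] p) := by
  let f := unfoldMap T k i
  have e : line[ℝ, f (T.points (k (i + 1) + 1)), f (T.points (k (i + 1) + 2))] =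
      (line[ℝ, T.points (k (i + 1) + 1), T.points (k (i + 1) + 2)]).map
        f.toAffineIsometry.toAffineMap := by
    rw [AffineSubspace.map_span, Set.image_pair]; rfl
  have e' := EuclideanGeometry.eq_reflection_of_eq_subspace e (f p)
  exact e'.trans (EuclideanGeometry.reflection_map _ f.toAffineIsometry p)

theorem reflection_add_of_mem {s : AffineSubspace ℝ Plane} [Nonempty s] {p : Plane} (hp : p ∈ s)
    (v : Plane) : EuclideanGeometry.reflection s (p + v) = p + s.direction.reflection v := by
  rw [EuclideanGeometry.reflection_apply_of_mem s _ hp, add_comm p v]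
  simp [add_comm]

theorem side_subset_sideLine (i : Fin 3) {p : Plane} (h : p ∈ side T i) : p ∈ sideLine T i := by
  rw [side, ← affineSegment_eq_segment] at h
  exact affineSegment_subset_affineSpan ℝ _ _ h

theorem isometry_add (ρ : Plane ≃ᵃⁱ[ℝ] Plane) (p v : Plane) :
    ρ (p + v) = ρ p + ρ.linearIsometryEquiv v := by
  have := ρ.map_vadd p v
  simpa [add_comm] using this

/-- The `i`-th unfolding map straightens the flight after the `i`-th strike: the new reflection
fixes the point of the strike and undoes the bounce. -/
theorem IsStrikeSequence.unfoldMap_apply {α : PeriodicCurve T} {t : ℕ → ℝ}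
    {k : ℕ → Fin 3} (h : IsStrikeSequence α t k) {w : Plane} (hw : DepartsWith α.toFun α.a w)
    (i : ℕ) : ∀ u, DepartsWith α.toFun (t i) u →
      unfoldMap T k i (α.toFun (t i)) = α.toFun α.a + (t i - α.a) • w ∧
      (unfoldMap T k i).linearIsometryEquiv u = w ∧
      α.toFun (t (i + 1)) = α.toFun (t i) + (t (i + 1) - t i) • u ∧
      ArrivesWith α.toFun (t (i + 1)) u := by
  have hfl : ∀ i u, DepartsWith α.toFun (t i) u →
      α.toFun (t (i + 1)) = α.toFun (t i) + (t (i + 1) - t i) • u ∧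
      ArrivesWith α.toFun (t (i + 1)) u := by
    intro i u hu
    refine α.nonsingular.flight (h.strictMono (Nat.lt_succ_self i)) hu fun s hs j hj => ?_
    have ha : α.a ≤ t i := by rw [← h.zero]; exact h.strictMono.monotone (Nat.zero_le i)
    have hmem : s ∈ Set.range t := by
      rw [h.range]
      exact ⟨ha.trans hs.1.le, j, hj⟩
    obtain ⟨n, rfl⟩ := hmem
    have h1 := h.strictMono.lt_iff_lt.1 hs.1
    have h2 := h.strictMono.lt_iff_lt.1 hs.2
    omega
  induction i with
  | zero =>
    intro u hu
    have hfl0 := hfl 0 u hu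
    rw [h.zero] at hu
    obtain rfl := hu.unique hw
    refine ⟨?_, rfl, hfl0⟩
    rw [h.zero, sub_self, zero_smul, add_zero]; rfl
  | succ i ih =>
    intro u hu
    obtain ⟨x, hx⟩ := α.nonsingular.exists_departsWith (t i)
    obtain ⟨h1, h2, h3, h4⟩ := ih x hx
    have hmem := h.mem_side (i + 1)
    have hu' := (α.nonsingular.eq_reflection h4 hu).2 _ hmem
    have hline := side_subset_sideLine _ hmem
    have key : ∀ v, unfoldMap T k (i + 1) (α.toFun (t (i + 1)) + v) =
        α.toFun α.a + (t (i + 1) - α.a) • w +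
          (unfoldMap T k i).linearIsometryEquiv
            ((sideLine T (k (i + 1))).direction.reflection v) := by
      intro v
      rw [unfoldMap_succ]
      have e := reflection_add_of_mem
        (s := line[ℝ, T.points (k (i + 1) + 1), T.points (k (i + 1) + 2)]) hline v
      refine (congrArg (unfoldMap T k i) e).trans ?_
      rw [isometry_add, h3, isometry_add, h1, map_smul, h2]
      refine congrArg₂ (· + ·) ?_ rfl
      module
    have hp : unfoldMap T k (i + 1) (α.toFun (t (i + 1))) =
        α.toFun α.a + (t (i + 1) - α.a) • w := by simpa using key 0
    refine ⟨hp, ?_, hfl _ u hu⟩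
    have e := key u
    rw [isometry_add, hp] at e
    rw [add_left_cancel e, hu', Submodule.reflection_reflection, h2]

theorem PeriodicCurve.apply_add (α : PeriodicCurve T) (t : ℝ) :
    α.toFun (t + (α.b - α.a)) = α.toFun t := by
  have := α.periodic (t - α.a)
  rw [add_sub_cancel] at this
  rw [this]; congr 1; ring

theorem PeriodicCurve.add_mem_strikes (α : PeriodicCurve T) (t : ℝ) :
    t + (α.b - α.a) ∈ α.strikes ↔ t ∈ α.strikes := by
  simp only [PeriodicCurve.strikes, Set.mem_ofPred_eq, α.apply_add]

theorem IsStrikeSequence.eq_b {α : PeriodicCurve T} {t : ℕ → ℝ} {k : ℕ → Fin 3}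
    (h : IsStrikeSequence α t k) : t α.period = α.b ∧ 1 ≤ α.period := by
  have hb : α.b ∈ Set.range t := by
    rw [h.range]
    refine ⟨α.a_lt_b.le, ?_⟩
    have := α.add_mem_strikes α.a
    rw [add_sub_cancel] at this
    rw [this]
    have h0 : t 0 ∈ Set.Ici α.a ∩ α.strikes := by rw [← h.range]; exact ⟨0, rfl⟩
    rw [h.zero] at h0
    exact h0.2
  obtain ⟨j, hj⟩ := hb
  -- If `b` is the strike number `j`, counting from `0` at `a`, then exactly the strikes `0, …, j -
  -- 1` lie in `[a, b)`.
  have e : Set.Ico α.a α.b ∩ α.strikes = t '' (Finset.range j : Finset ℕ) := by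
    ext s
    constructor
    · rintro ⟨⟨h1, h2⟩, h3⟩
      have : s ∈ Set.range t := by rw [h.range]; exact ⟨h1, h3⟩
      obtain ⟨n, rfl⟩ := this
      rw [← hj] at h2
      exact ⟨n, by simpa using h.strictMono.lt_iff_lt.1 h2, rfl⟩
    · rintro ⟨n, hn, rfl⟩
      have : t n ∈ Set.Ici α.a ∩ α.strikes := by rw [← h.range]; exact ⟨n, rfl⟩
      exact ⟨⟨this.1, by rw [← hj]; exact h.strictMono (by simpa using hn)⟩, this.2⟩
  have hp : α.period = j := by
    rw [PeriodicCurve.period, e, Set.ncard_image_of_injective _ h.strictMono.injective,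
      Set.ncard_coe_finset, Finset.card_range]
  rw [hp]
  refine ⟨hj, Nat.one_le_iff_ne_zero.2 fun h0 => ?_⟩
  rw [h0, h.zero] at hj
  exact α.a_lt_b.ne hj

theorem PeriodicCurve.finite_strikes_Ico (hT : T.Equilateral) (α : PeriodicCurve T) (n : ℕ) :
    (Set.Ico α.a (α.a + n * (α.b - α.a)) ∩ α.strikes).Finite := by
  obtain ⟨w, hw⟩ := α.nonsingular.exists_departsWith α.a
  have h0 := (α.translation_or_fagnano hT hw).1
  induction n with
  | zero => simp
  | succ n ih =>
    refine (h0.union (ih.image fun t => t + (α.b - α.a))).subset ?_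
    rintro t ⟨⟨h1, h2⟩, h3⟩
    rcases lt_or_ge t α.b with hb | hb
    · exact Or.inl ⟨⟨h1, hb⟩, h3⟩
    · refine Or.inr ⟨t - (α.b - α.a), ⟨⟨by linarith, ?_⟩, ?_⟩, by simp⟩
      · push_cast at h2; linarith
      · rw [← α.add_mem_strikes, sub_add_cancel]; exact h3

theorem PeriodicCurve.finite_strikes_Icc (hT : T.Equilateral) (α : PeriodicCurve T) (c : ℝ) :
    (Set.Icc α.a c ∩ α.strikes).Finite := by
  obtain ⟨n, hn⟩ := exists_nat_gt ((c - α.a) / (α.b - α.a))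
  rw [div_lt_iff₀ (sub_pos.2 α.a_lt_b)] at hn
  exact (α.finite_strikes_Ico hT n).subset
    (Set.inter_subset_inter_left _ fun t ht => ⟨ht.1, by linarith [ht.2]⟩)

theorem PeriodicCurve.exists_isStrikeSequence (hT : T.Equilateral) (α : PeriodicCurve T)
    (ha : α.a ∈ α.strikes) : ∃ t k, IsStrikeSequence α t k := by
  have hnext : ∀ t, α.a ≤ t ∧ t ∈ α.strikes →
      ∃ s, s ∈ α.strikes ∧ t < s ∧ ∀ x ∈ α.strikes, t < x → s ≤ x := by
    rintro t ⟨hat, ht⟩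
    have hL := sub_pos.2 α.a_lt_b
    have hfin : (Set.Ioc t (t + (α.b - α.a)) ∩ α.strikes).Finite :=
      (α.finite_strikes_Icc hT (t + (α.b - α.a))).subset
        (Set.inter_subset_inter_left _ fun x hx => ⟨hat.trans hx.1.le, hx.2⟩)
    obtain ⟨s, hs, hmin⟩ := Set.exists_min_image _ id hfin
      ⟨t + (α.b - α.a), ⟨by linarith, le_rfl⟩, (α.add_mem_strikes t).2 ht⟩
    refine ⟨s, hs.2, hs.1.1, fun x hx htx => ?_⟩
    rcases le_or_gt x (t + (α.b - α.a)) with h | h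
    · exact hmin x ⟨⟨htx, h⟩, hx⟩
    · exact hs.1.2.trans h.le
  choose! f hf using hnext
  let t : ℕ → ℝ := fun n => f^[n] α.a
  have hsucc : ∀ n, t (n + 1) = f (t n) := fun n => Function.iterate_succ_apply' f n α.a
  have ht : ∀ n, α.a ≤ t n ∧ t n ∈ α.strikes := by
    intro n
    induction n with
    | zero => exact ⟨le_rfl, ha⟩
    | succ n ih =>
      have := hf (t n) ih
      rw [hsucc]
      exact ⟨ih.1.trans this.2.1.le, this.1⟩
  have hmono : StrictMono t := strictMono_nat_of_lt_succ fun n => by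
    rw [hsucc]; exact (hf (t n) (ht n)).2.1
  choose k hk using fun n => (ht n).2
  refine ⟨t, k, rfl, hmono, Set.Subset.antisymm ?_ ?_, hk⟩
  · rintro _ ⟨n, rfl⟩
    exact ht n
  · rintro s ⟨hs1, hs2⟩
    by_contra hs
    have hlt : ∀ n, t n < s := by
      intro n
      induction n with
      | zero => exact lt_of_le_of_ne hs1 fun h => hs ⟨0, h⟩
      | succ n ih =>
        refine lt_of_le_of_ne ?_ fun h => hs ⟨n + 1, h⟩
        rw [hsucc]
        exact (hf (t n) (ht n)).2.2 s hs2 ih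
    refine Set.infinite_range_of_injective hmono.injective
      ((α.finite_strikes_Icc hT s).subset ?_)
    rintro _ ⟨n, rfl⟩
    exact ⟨⟨(ht n).1, (hlt n).le⟩, (ht n).2⟩

theorem cv_base : cv T (T.points 2 - T.points 1) = (1, 0) := by
  have : T.points 2 - T.points 1 = frame T (1, 0) := by simp [frame_apply]
  rw [this, cv_frame]

/-- With `r` the length of `v` and `q = √3`, the left side bounds the horizontal component `v.1 +
v.2 / 2` by `r` times the cosines of 30° and 60°. Squaring turns the bounds into `v.1 ≤ v.2` and `0
≤ v.1`. -/
theorem sector_iff_of_sq {v : ℝ × ℝ} {q r : ℝ} (hv : 0 < v.2) (hr : 0 < r)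
    (hr2 : r ^ 2 = normSq v) (hq : 0 < q) (hq2 : q ^ 2 = 3) :
    v.1 + v.2 / 2 ≤ q / 2 * r ∧ 1 / 2 * r ≤ v.1 + v.2 / 2 ↔ Sector v := by
  obtain ⟨x, y⟩ := v
  simp only [normSq, Sector] at *
  constructor
  · rintro ⟨h1, h2⟩
    have h4 : r ≤ 2 * x + y := by linarith
    have h5 : r ^ 2 ≤ (2 * x + y) ^ 2 := pow_le_pow_left₀ hr.le h4 2
    have h6 : (2 * x + y) ^ 2 ≤ (q * r) ^ 2 := pow_le_pow_left₀ (hr.le.trans h4) (by linarith) 2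
    rw [mul_pow, hq2, hr2] at h6
    rw [hr2] at h5
    have hx : 0 ≤ x := by
      by_contra! hx
      nlinarith [mul_neg_of_neg_of_pos hx (show 0 < x + y by linarith)]
    refine ⟨hx, ?_⟩
    by_contra! hxy
    nlinarith [mul_pos (sub_pos.2 hxy) (show 0 < x + 2 * y by linarith)]
  · rintro ⟨hx, hxy⟩
    have hx2 : 0 ≤ 2 * x + y := by linarith
    constructor
    · have : 2 * x + y ≤ q * r := by
        refine (sq_le_sq₀ hx2 (by positivity)).1 ?_
        rw [mul_pow, hq2, hr2]
        nlinarith [mul_nonneg (sub_nonneg.2 hxy) (show 0 ≤ x + 2 * y by linarith)]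
      linarith
    · have : r ≤ 2 * x + y := by
        refine (sq_le_sq₀ hr.le hx2).1 ?_
        rw [hr2]
        nlinarith [mul_nonneg hx hv.le]
      linarith

/-- The angle is unoriented, so the cosine decides only once `w` is known to point upwards. -/
theorem angle_mem_iff_sector (hT : T.Equilateral) {w : Plane} (hw : 0 < (cv T w).2) :
    InnerProductGeometry.angle w (T.points 2 - T.points 1) ∈ Set.Icc (Real.pi / 6) (Real.pi / 3) ↔
      Sector (cv T w) := by
  obtain ⟨s, hs, hin⟩ := inner_points hT
  have hnorm : ∀ u : Plane, ‖u‖ = s * Real.sqrt (normSq (cv T u)) := by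
    intro u
    have h1 := hin u u
    rw [real_inner_self_eq_norm_sq] at h1
    have h2 : ‖u‖ ^ 2 = s ^ 2 * normSq (cv T u) := by rw [h1, normSq]; ring
    rw [← Real.sqrt_sq (norm_nonneg u), h2, Real.sqrt_mul (sq_nonneg s), Real.sqrt_sq hs.le]
  have hN : 0 < normSq (cv T w) := normSq_pos fun h => by rw [h] at hw; exact lt_irrefl _ hw
  have hcos : Real.cos (InnerProductGeometry.angle w (T.points 2 - T.points 1)) =
      ((cv T w).1 + (cv T w).2 / 2) / Real.sqrt (normSq (cv T w)) := by
    rw [InnerProductGeometry.cos_angle, hin, hnorm, hnorm, cv_base]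
    have := Real.sqrt_pos.2 hN
    simp [normSq]
    simp [normSq] at this
    field_simp
  have h0 := InnerProductGeometry.angle_nonneg w (T.points 2 - T.points 1)
  have hpi := InnerProductGeometry.angle_le_pi w (T.points 2 - T.points 1)
  have hpp := Real.pi_pos
  have e1 := Real.strictAntiOn_cos.le_iff_ge (a := InnerProductGeometry.angle w
    (T.points 2 - T.points 1)) (b := Real.pi / 6) ⟨h0, hpi⟩ ⟨by linarith, by linarith⟩
  have e2 := Real.strictAntiOn_cos.le_iff_ge (b := InnerProductGeometry.angle w
    (T.points 2 - T.points 1)) (a := Real.pi / 3) ⟨by linarith, by linarith⟩ ⟨h0, hpi⟩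
  rw [Set.mem_Icc, ← e1, ← e2, hcos, Real.cos_pi_div_six, Real.cos_pi_div_three]
  have hr := Real.sqrt_pos.2 hN
  rw [div_le_iff₀ hr, le_div_iff₀ hr]
  have hr2 := Real.sq_sqrt hN.le
  have h3 := Real.sq_sqrt (show (0 : ℝ) ≤ 3 by norm_num)
  have h3p := Real.sqrt_pos.2 (show (0 : ℝ) < 3 by norm_num)
  exact sector_iff_of_sq hw hr hr2 h3p h3

/-- The unfoldings are the segments, beginning on `BC`, with a direction in the sector. -/
theorem PeriodicCurve.unfoldsTo_iff (hT : T.Equilateral) (α : PeriodicCurve T) (P Q : Plane) :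
    α.UnfoldsTo P Q ↔ α.toFun α.a = P ∧ P ∈ side T 0 ∧
      ∃ w, DepartsWith α.toFun α.a w ∧ Sector (cv T w) ∧ Q = P + (α.b - α.a) • w := by
  have hpos : ∀ {w}, DepartsWith α.toFun α.a w → α.toFun α.a ∈ side T 0 → 0 < (cv T w).2 :=
    fun hw h => hw.dbary_pos hT α.nonsingular ((α.nonsingular.mem_side_iff _ 0).1 h)
  have hQ : ∀ {t k w}, IsStrikeSequence α t k → DepartsWith α.toFun α.a w →
      unfoldMap T k (α.period - 1) (α.toFun α.a) = α.toFun α.a + (α.b - α.a) • w := by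
    intro t k w h hw
    obtain ⟨hb, h1⟩ := h.eq_b
    obtain ⟨u, hu⟩ := α.nonsingular.exists_departsWith (t (α.period - 1))
    obtain ⟨e1, e2, e3, -⟩ := h.unfoldMap_apply hw _ u hu
    rw [Nat.sub_add_cancel h1, hb, α.apply_b] at e3
    conv_lhs => rw [e3]
    rw [isometry_add, e1, map_smul, e2]
    module
  constructor
  · rintro ⟨rfl, h0, ⟨w, hw, hang⟩, t, k, hs, rfl⟩
    exact ⟨rfl, h0, w, hw, (angle_mem_iff_sector hT (hpos hw h0)).1 hang, hQ hs hw⟩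
  · rintro ⟨rfl, h0, w, hw, hsec, rfl⟩
    obtain ⟨t, k, hs⟩ := α.exists_isStrikeSequence hT ⟨0, h0⟩
    exact ⟨rfl, h0, ⟨w, hw, (angle_mem_iff_sector hT (hpos hw h0)).2 hsec⟩, t, k, hs,
      (hQ hs hw).symm⟩

/-! ### Relabellings -/

/-- A transposition is induced by the reflection in the perpendicular bisector of a side, which
passes through the third vertex; transpositions generate. -/
theorem exists_relabelling (hT : T.Equilateral) (σ : Equiv.Perm (Fin 3)) :
    ∃ ρ : Plane ≃ᵃⁱ[ℝ] Plane, ∀ i, ρ (T.points i) = T.points (σ i) := by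
  induction σ using Equiv.Perm.swap_induction_on with
  | one => exact ⟨AffineIsometryEquiv.refl ℝ Plane, fun i => rfl⟩
  | swap_mul σ x y hxy ih =>
    obtain ⟨ρ, hρ⟩ := ih
    obtain ⟨z, hzx, hzy, hz⟩ : ∃ z : Fin 3, z ≠ x ∧ z ≠ y ∧ ∀ i, i = x ∨ i = y ∨ i = z := by
      revert x y; decide
    let s : AffineSubspace ℝ Plane :=
      AffineSubspace.mk' (T.points z) (ℝ ∙ (T.points x - T.points y))ᗮ
    have hzs : T.points z ∈ s := AffineSubspace.self_mem_mk' _ _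
    have : Nonempty s := ⟨⟨_, hzs⟩⟩
    have hdir : s.direction = (ℝ ∙ (T.points x - T.points y))ᗮ := AffineSubspace.direction_mk' _ _
    have href : ∀ v, EuclideanGeometry.reflection s (T.points z + v) =
        T.points z + (ℝ ∙ (T.points x - T.points y))ᗮ.reflection v := by
      intro v
      rw [reflection_add_of_mem hzs]
      simp only [hdir]
    have hsub : T.points x - T.points y = (T.points x - T.points z) - (T.points y - T.points z) := by
      abel
    have hn : ‖T.points x - T.points z‖ = ‖T.points y - T.points z‖ := by
      rw [← dist_eq_norm, ← dist_eq_norm]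
      exact hT.dist_eq hzx.symm hzy.symm
    have hn1 := Submodule.reflection_sub hn
    have hn2 := Submodule.reflection_sub hn.symm
    have hspan : ℝ ∙ ((T.points y - T.points z) - (T.points x - T.points z)) =
        ℝ ∙ ((T.points x - T.points z) - (T.points y - T.points z)) := by
      rw [← neg_sub, ← Set.neg_singleton, Submodule.span_neg]
    simp only [hspan] at hn2
    rw [← hsub] at hn1
    simp only [← hsub] at hn2
    have hx : EuclideanGeometry.reflection s (T.points x) = T.points y := by
      have := href (T.points x - T.points z)
      rwa [hn1, add_sub_cancel, add_sub_cancel] at this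
    have hy : EuclideanGeometry.reflection s (T.points y) = T.points x := by
      have := href (T.points y - T.points z)
      rwa [hn2, add_sub_cancel, add_sub_cancel] at this
    have hz' : EuclideanGeometry.reflection s (T.points z) = T.points z := by
      simpa using href 0
    refine ⟨ρ.trans (EuclideanGeometry.reflection s), fun i => ?_⟩
    rw [AffineIsometryEquiv.coe_trans, Function.comp_apply, hρ, Equiv.Perm.mul_apply]
    rcases hz (σ i) with h | h | h <;> rw [h]
    · rw [Equiv.swap_apply_left, hx]
    · rw [Equiv.swap_apply_right, hy]
    · rw [Equiv.swap_apply_of_ne_of_ne hzx hzy, hz']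

variable {ρ : Plane ≃ᵃⁱ[ℝ] Plane} {σ : Equiv.Perm (Fin 3)}

theorem bary_relabel (hρ : ∀ i, ρ (T.points i) = T.points (σ i)) (p : Plane) (i : Fin 3) :
    bary (σ i) (co T (ρ p)) = bary i (co T p) := by
  have h1 : ρ p = ∑ j, bary (σ.symm j) (co T p) • T.points j := by
    conv_lhs => rw [← sum_bary_co T p]
    rw [← Finset.affineCombination_eq_linear_combination _ _ _ (sum_bary _)]
    have := Finset.univ.map_affineCombination T.points (fun i => bary i (co T p)) (sum_bary _)
      ρ.toAffineEquiv.toAffineMap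
    refine this.trans ?_
    rw [Finset.affineCombination_eq_linear_combination _ _ _ (sum_bary _),
      ← Equiv.sum_comp σ (fun j => bary (σ.symm j) (co T p) • T.points j)]
    refine Finset.sum_congr rfl fun j _ => ?_
    rw [Equiv.symm_apply_apply, ← hρ]
    rfl
  rw [h1, bary_co_sum, Equiv.symm_apply_apply]
  rw [Equiv.sum_comp σ.symm (fun j => bary j (co T p))]
  exact sum_bary _

theorem dbary_relabel (hρ : ∀ i, ρ (T.points i) = T.points (σ i)) (u : Plane) (i : Fin 3) :
    dbary (σ i) (cv T (ρ.linearIsometryEquiv u)) = dbary i (cv T u) := by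
  have h1 := bary_relabel hρ (T.points 0 + (1 : ℝ) • u) i
  rw [isometry_add, map_smul, co_add_smul, co_add_smul, bary_add_smul, bary_add_smul,
    bary_relabel hρ] at h1
  linarith

theorem DepartsWith.relabel {α : ℝ → Plane} {t : ℝ} {w : Plane} (h : DepartsWith α t w)
    (ρ : Plane ≃ᵃⁱ[ℝ] Plane) : DepartsWith (fun t => ρ (α t)) t (ρ.linearIsometryEquiv w) := by
  obtain ⟨ε, hε, h⟩ := h
  refine ⟨ε, hε, fun c hc => ?_⟩
  simp only [h c hc, isometry_add, map_smul]

theorem ArrivesWith.relabel {α : ℝ → Plane} {t : ℝ} {w : Plane} (h : ArrivesWith α t w)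
    (ρ : Plane ≃ᵃⁱ[ℝ] Plane) : ArrivesWith (fun t => ρ (α t)) t (ρ.linearIsometryEquiv w) := by
  obtain ⟨ε, hε, h⟩ := h
  refine ⟨ε, hε, fun c hc => ?_⟩
  simp only [h c hc]
  rw [sub_eq_add_neg, isometry_add, map_neg, map_smul, ← sub_eq_add_neg]

theorem IsNonsingularTrajectory.relabel (hT : T.Equilateral) {α : ℝ → Plane}
    (hα : IsNonsingularTrajectory T α) (hρ : ∀ i, ρ (T.points i) = T.points (σ i)) :
    IsNonsingularTrajectory T fun t => ρ (α t) := by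
  have htri : ∀ t, Tri (co T (ρ (α t))) := by
    intro t i
    have := bary_relabel hρ (α t) (σ.symm i)
    rw [Equiv.apply_symm_apply] at this
    rw [this]
    exact hα.tri t _
  have hside : ∀ t i, ρ (α t) ∈ side T (σ i) ↔ α t ∈ side T i := by
    intro t i
    rw [hα.mem_side_iff, Billiard.mem_side_iff, bary_relabel hρ]
    exact and_iff_right (htri t)
  refine ⟨fun t => (mem_closedInterior_iff T _).2 (htri t), fun t i h => ?_, ?_⟩
  · have h1 := hρ (σ.symm i)
    rw [Equiv.apply_symm_apply, ← h] at h1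
    exact hα.ne_vertex t _ (ρ.injective h1).symm
  · obtain ⟨c, hc, h⟩ := hα.motion
    refine ⟨c, hc, fun t => ?_⟩
    obtain ⟨u, w, hu, hw, h1, h2, h3, h4⟩ := h t
    refine ⟨ρ.linearIsometryEquiv u, ρ.linearIsometryEquiv w, by simpa, by simpa, h1.relabel ρ,
      h2.relabel ρ, fun hs => ?_, fun i hi => ?_⟩
    · rw [h3 fun i hi => hs (σ i) ((hside t i).2 hi)]
    · obtain ⟨i, rfl⟩ := σ.surjective i
      have h5 := h4 i ((hside t i).1 hi)
      apply cv_injective T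
      rw [cv_reflection hT]
      apply ext_dbary
      intro j
      obtain ⟨j, rfl⟩ := σ.surjective j
      rw [dbary_refl, dbary_relabel hρ, dbary_relabel hρ, dbary_relabel hρ, h5, cv_reflection hT,
        dbary_refl]
      simp only [σ.injective.eq_iff]

/-- A relabelling acts on the directions as an element of the point group or its negative. -/
theorem exists_pointGroup_relabel (hρ : ∀ i, ρ (T.points i) = T.points (σ i)) :
    ∃ (i : Fin 6) (s : ℝ), (s = 1 ∨ s = -1) ∧
      ∀ u, cv T (ρ.linearIsometryEquiv u) = s • pointGroup i (cv T u) := by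
  have h : ∀ u, cv T (ρ.linearIsometryEquiv u) =
      (dbary (σ.symm 2) (cv T u), dbary (σ.symm 0) (cv T u)) := by
    intro u
    have h0 := dbary_relabel hρ u (σ.symm 0)
    have h2 := dbary_relabel hρ u (σ.symm 2)
    rw [Equiv.apply_symm_apply] at h0 h2
    exact Prod.ext h2 h0
  have hne : σ.symm 2 ≠ σ.symm 0 := by simp
  simp only [h]
  generalize σ.symm 2 = i at *
  generalize σ.symm 0 = j at *
  -- The odd permutations reflect in the altitudes, and a reflection in an altitude has linear part
  -- minus that of the reflection in the side: hence the sign.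
  fin_cases i <;> fin_cases j <;> simp at hne
  · exact ⟨2, 1, by simp, fun u => by ext <;> simp [dbary, pointGroup]⟩
  · exact ⟨4, -1, by simp, fun u => by ext <;> simp [dbary, pointGroup]⟩
  · exact ⟨3, -1, by simp, fun u => by ext <;> simp [dbary, pointGroup]; ring⟩
  · exact ⟨1, 1, by simp, fun u => by ext <;> simp [dbary, pointGroup]⟩
  · exact ⟨0, 1, by simp, fun u => by ext <;> simp [dbary, pointGroup]⟩
  · exact ⟨5, -1, by simp, fun u => by ext <;> simp [dbary, pointGroup]; ring⟩

/-! ### Existence and uniqueness of unfoldings -/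

/-- Every orbit has an unfolding. -/
theorem PeriodicCurve.exists_unfoldsTo (hT : T.Equilateral) (α : PeriodicCurve T) :
    ∃ (β : PeriodicCurve T) (P Q : Plane), α.Same β ∧ β.UnfoldsTo P Q := by
  have hα := α.nonsingular
  obtain ⟨w, hw⟩ := hα.exists_departsWith α.a
  -- Some family is crossed at an angle between 30° and 60°. Starting at such a crossing, a
  -- relabelling makes the struck side `BC` and, by exchanging `B` and `C` if necessary, the motion
  -- rightward.
  obtain ⟨j, hj1, hj2⟩ := exists_middle_fam (cv T w)
  have hj0 := fam_ne_zero_of_middle (hw.ne_zero hα) hj2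
  obtain ⟨t, ht⟩ : ∃ t, fam j (co T (α.toFun α.a) + (t - α.a) • cv T w) = (0 : ℤ) :=
    ⟨α.a - fam j (co T (α.toFun α.a)) / fam j (cv T w), by
      rw [fam_add_smul]; field_simp; simp⟩
  obtain ⟨u, hu⟩ := hα.exists_departsWith t
  have hr := hα.rel_line hT hw t hu
  obtain ⟨j', n', hn', hjj⟩ := hr.fam ht
  obtain ⟨i, hi, hij⟩ := (hα.tri t).exists_bary_eq_zero (hα.not_isLat t) hn'
  have hsq : dbary i (cv T u) ^ 2 = fam j (cv T w) ^ 2 := by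
    rw [sq_eq_sq_iff_abs_eq_abs, hij, hjj]
  rw [← hsq, ← hr.normSq] at hj1 hj2
  have hpos := hu.dbary_pos hT hα hi
  obtain ⟨σ, hσ0, hσ⟩ : ∃ σ : Equiv.Perm (Fin 3), σ i = 0 ∧
      dbary (σ.symm 1) (cv T u) ≤ dbary (σ.symm 2) (cv T u) := by
    obtain ⟨τ, hτ⟩ : ∃ τ : Equiv.Perm (Fin 3), τ i = 0 := ⟨Equiv.swap i 0, by simp⟩
    rcases le_total (dbary (τ.symm 1) (cv T u)) (dbary (τ.symm 2) (cv T u)) with h | h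
    · exact ⟨τ, hτ, h⟩
    · refine ⟨τ.trans (Equiv.swap 1 2), ?_, ?_⟩
      · rw [Equiv.trans_apply, hτ]; decide
      · simpa [Equiv.symm_trans_apply] using h
  obtain ⟨ρ, hρ⟩ := exists_relabelling hT σ
  let β : PeriodicCurve T :=
    { toFun := fun t => ρ (α.toFun t)
      a := t
      b := t + (α.b - α.a)
      a_lt_b := by linarith [α.a_lt_b]
      nonsingular := hα.relabel hT hρ
      periodic := fun s => by
        have := α.apply_add (t + s)
        rw [← this]; congr 2; ring }
  have h0 : β.toFun β.a ∈ side T 0 := by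
    rw [β.nonsingular.mem_side_iff, ← hσ0]
    exact (bary_relabel hρ _ i).trans hi
  have hsec : Sector (cv T (ρ.linearIsometryEquiv u)) := by
    have hd : ∀ j, dbary j (cv T (ρ.linearIsometryEquiv u)) = dbary (σ.symm j) (cv T u) := by
      intro j
      rw [← dbary_relabel hρ u (σ.symm j), Equiv.apply_symm_apply]
    have hd0 := hd 0
    have hd1 := hd 1
    have hd2 := hd 2
    have hσ0' : σ.symm 0 = i := by rw [← hσ0, Equiv.symm_apply_apply]
    rw [hσ0'] at hd0
    have hN : normSq (cv T (ρ.linearIsometryEquiv u)) = normSq (cv T u) := by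
      rw [normSq_eq, normSq_eq, ← Equiv.sum_comp σ]
      simp only [dbary_relabel hρ]
    have e0 : ∀ v, dbary 0 v = v.2 := fun v => rfl
    have e1 : ∀ v, dbary 1 v = -v.1 - v.2 := fun v => rfl
    have e2 : ∀ v, dbary 2 v = v.1 := fun v => rfl
    rw [e0] at hd0
    rw [e1] at hd1
    rw [e2] at hd2
    apply sector_of_middle
    · rw [hd0]; exact hpos
    · linarith
    · rw [hd0, hN]; exact hj1
    · rw [hd0, hN]; exact hj2
  refine ⟨β, _, _, ⟨ρ, ⟨σ, hρ⟩, 1, 0, one_ne_zero, fun t => by simp [β], by simp [β]⟩,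
    (β.unfoldsTo_iff hT _ _).2 ⟨rfl, h0, ρ.linearIsometryEquiv u, hu.relabel ρ, hsec, rfl⟩⟩

/-- The parametrizations of an orbit have the same period vector, up to the point group and the
sign. -/
theorem PeriodicCurve.Same.exists_pointGroup (hT : T.Equilateral) {α β : PeriodicCurve T}
    (h : α.Same β) {w w' : Plane} (hw : DepartsWith α.toFun α.a w)
    (hw' : DepartsWith β.toFun β.a w') : ∃ (i : Fin 6) (s : ℝ), (s = 1 ∨ s = -1) ∧
      (β.b - β.a) • cv T w' = s • pointGroup i ((α.b - α.a) • cv T w) := by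
  obtain ⟨ρ, ⟨σ, hρ⟩, m, s, hm, hfun, hlen⟩ := h
  set t := (β.a - s) / m with ht
  have htm : m * t + s = β.a := by rw [ht]; field_simp; ring
  obtain ⟨y, hy, i, hyi⟩ : ∃ y, w' = m⁻¹ • ρ.linearIsometryEquiv y ∧
      ∃ i, cv T y = pointGroup i (cv T w) := by
    obtain ⟨u, hu⟩ := α.nonsingular.exists_departsWith t
    obtain ⟨x, hx⟩ := α.nonsingular.exists_arrivesWith t
    have hr := α.nonsingular.rel_line hT hw t hu
    rcases hm.lt_or_gt with hneg | hpos
    -- Reversing time turns the velocity of arrival into that of departure, which costs one more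
    -- bounce.
    · obtain ⟨i, -, -, -, -, hi⟩ := hr.trans (α.nonsingular.rel_bounce hT hx hu).symm
      refine ⟨x, hw'.unique ?_, i, hi⟩
      obtain ⟨ε, hε, he⟩ := hx
      refine ⟨ε * (-m), mul_pos hε (by linarith), fun c hc => ?_⟩
      have e1 : β.a + c = m * (t - (c / -m)) + s := by rw [← htm]; field_simp; ring
      have e2 : c / -m ∈ Set.Icc 0 ε :=
        ⟨div_nonneg hc.1 (by linarith), (div_le_iff₀ (by linarith)).2 hc.2⟩
      rw [e1, ← htm, hfun, hfun, he _ e2, sub_eq_add_neg, isometry_add, map_neg, map_smul,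
        smul_smul, ← neg_smul]
      congr 2
      field_simp
    · obtain ⟨i, -, -, -, -, hi⟩ := hr
      refine ⟨u, hw'.unique ?_, i, hi⟩
      obtain ⟨ε, hε, he⟩ := hu
      refine ⟨ε * m, mul_pos hε hpos, fun c hc => ?_⟩
      have e1 : β.a + c = m * (t + (c / m)) + s := by rw [← htm]; field_simp; ring
      have e2 : c / m ∈ Set.Icc 0 ε :=
        ⟨div_nonneg hc.1 hpos.le, (div_le_iff₀ hpos).2 hc.2⟩
      rw [e1, ← htm, hfun, hfun, he _ e2, isometry_add, map_smul, smul_smul]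
      congr 2
  obtain ⟨i', s', hs', hi'⟩ := exists_pointGroup_relabel hρ
  obtain ⟨k, hk⟩ := pointGroup_comp i' i
  have hs'' : |m| * m⁻¹ * s' = 1 ∨ |m| * m⁻¹ * s' = -1 := by
    rcases hm.lt_or_gt with hneg | hpos
    · rw [abs_of_neg hneg]
      rcases hs' with rfl | rfl
      · right; field_simp
      · left; field_simp
    · rw [abs_of_pos hpos]
      rcases hs' with rfl | rfl
      · left; field_simp
      · right; field_simp
  refine ⟨k, _, hs'', ?_⟩
  rw [hlen, hy, cv_smul, hi', hyi, hk, pointGroup_smul]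
  simp only [smul_smul]
  congr 1
  ring

/-- All unfoldings of an orbit have the same direction and length. -/
theorem PeriodicCurve.UnfoldsTo.sub_eq_sub (hT : T.Equilateral) {α β : PeriodicCurve T}
    {P Q R S : Plane} (hα : α.UnfoldsTo P Q) (hβ : β.UnfoldsTo R S) (h : α.Same β) :
    Q - P = S - R := by
  obtain ⟨-, -, w, hw, hsw, rfl⟩ := (α.unfoldsTo_iff hT _ _).1 hα
  obtain ⟨-, -, w', hw', hsw', rfl⟩ := (β.unfoldsTo_iff hT _ _).1 hβ
  rw [add_sub_cancel_left, add_sub_cancel_left]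
  apply cv_injective T
  rw [cv_smul, cv_smul]
  have hscale : ∀ {c : ℝ} {v : ℝ × ℝ}, 0 < c → Sector v → Sector (c • v) := fun hc h =>
    ⟨mul_nonneg hc.le h.1, mul_le_mul_of_nonneg_left h.2 hc.le⟩
  obtain ⟨i, s, hs, he⟩ := h.exists_pointGroup hT hw hw'
  exact Sector.eq (hscale (sub_pos.2 α.a_lt_b) hsw) (hscale (sub_pos.2 β.a_lt_b) hsw') hs he

/-- An unfolding determines the orbit. -/
theorem PeriodicCurve.UnfoldsTo.same (hT : T.Equilateral) {α β : PeriodicCurve T} {P Q : Plane}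
    (hα : α.UnfoldsTo P Q) (hβ : β.UnfoldsTo P Q) : α.Same β := by
  obtain ⟨hP, -, w, hw, -, hQ⟩ := (α.unfoldsTo_iff hT _ _).1 hα
  obtain ⟨hP', -, w', hw', -, hQ'⟩ := (β.unfoldsTo_iff hT _ _).1 hβ
  have hposα := sub_pos.2 α.a_lt_b
  have hposβ := sub_pos.2 β.a_lt_b
  have hne := hposα.ne'
  have hww : (α.b - α.a) • w = (β.b - β.a) • w' := add_left_cancel (hQ.symm.trans hQ')
  -- After matching speeds both curves fold the same line, and the table has one point in each group
  -- orbit.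
  set m := (β.b - β.a) / (α.b - α.a) with hm
  have hmpos : 0 < m := div_pos hposβ hposα
  have hmw : w = m • w' := by
    have := congrArg (fun x => (α.b - α.a)⁻¹ • x) hww
    simp only [smul_smul, inv_mul_cancel₀ hne, one_smul] at this
    rw [this]; congr 1; rw [hm]; field_simp
  refine ⟨AffineIsometryEquiv.refl ℝ Plane, ⟨Equiv.refl _, fun _ => rfl⟩, m, β.a - m * α.a,
    hmpos.ne', fun t => ?_, ?_⟩
  · apply co_injective T
    have h1 := α.nonsingular.rel_line_point hT hw t
    have h2 := β.nonsingular.rel_line_point hT hw' (m * t + (β.a - m * α.a))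
    have e : (t - α.a) • cv T w = (m * t + (β.a - m * α.a) - β.a) • cv T w' := by
      rw [hmw, cv_smul, smul_smul]; congr 1; ring
    rw [hP, e] at h1
    rw [hP'] at h2
    exact (h2.symm.trans h1).eq_of_tri (β.nonsingular.tri _) (α.nonsingular.tri _)
  · rw [abs_of_pos hmpos, hm]; field_simp

/-! ### Orbits and their classes -/

theorem PeriodicCurve.orbit_eq_iff {α β : PeriodicCurve T} : α.orbit = β.orbit ↔ α.Same β :=
  Quotient.eq (r := orbitSetoid T)

theorem Orbit.exists_isUnfolding (hT : T.Equilateral) (o : Orbit T) :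
    ∃ P Q, o.IsUnfolding P Q := by
  obtain ⟨α, rfl⟩ := Quotient.exists_rep o
  obtain ⟨β, P, Q, h, hβ⟩ := α.exists_unfoldsTo hT
  exact ⟨P, Q, β, (PeriodicCurve.orbit_eq_iff.2 h).symm, hβ⟩

theorem Orbit.IsUnfolding.sub_eq_sub (hT : T.Equilateral) {o : Orbit T} {P Q R S : Plane}
    (h : o.IsUnfolding P Q) (h' : o.IsUnfolding R S) : Q - P = S - R := by
  obtain ⟨α, hα, h⟩ := h
  obtain ⟨β, hβ, h'⟩ := h'
  exact h.sub_eq_sub hT h' (PeriodicCurve.orbit_eq_iff.1 (hα.trans hβ.symm))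

theorem Orbit.IsUnfolding.eq (hT : T.Equilateral) {o o' : Orbit T} {P Q : Plane}
    (h : o.IsUnfolding P Q) (h' : o'.IsUnfolding P Q) : o = o' := by
  obtain ⟨α, rfl, h⟩ := h
  obtain ⟨β, rfl, h'⟩ := h'
  exact PeriodicCurve.orbit_eq_iff.2 (h.same hT h')

theorem Orbit.IsUnfolding.mem_side {o : Orbit T} {P Q : Plane} (h : o.IsUnfolding P Q) :
    P ∈ side T 0 := by
  obtain ⟨α, -, h⟩ := h
  exact h.2.1

theorem co_of_mem_side {P : Plane} (h : P ∈ side T 0) : co T P = ((co T P).1, 0) :=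
  Prod.ext rfl ((mem_side_iff T P 0).1 h).2

/-- All unfoldings begin on `BC`, so any two with the same vector differ by a horizontal
translation; equivalence compares only the vectors. -/
theorem Orbit.IsUnfolding.mem_cls_iff (hT : T.Equilateral) {o o' : Orbit T} {P Q : Plane}
    (h : o.IsUnfolding P Q) : o' ∈ o.cls ↔ ∃ R S, o'.IsUnfolding R S ∧ S - R = Q - P := by
  constructor
  · rintro ⟨P', Q', R, S, v, h1, h2, -, rfl, rfl⟩
    exact ⟨_, _, h2, by rw [add_sub_add_right_eq_sub]; exact h1.sub_eq_sub hT h⟩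
  · rintro ⟨R, S, h', he⟩
    refine ⟨P, Q, R, S, R - P, h, h', ⟨(co T R).1 - (co T P).1, ?_⟩, by abel, ?_⟩
    · apply cv_injective T
      rw [cv_sub_eq_co_sub, cv_smul, cv_base, co_of_mem_side h.mem_side,
        co_of_mem_side h'.mem_side]
      ext <;> simp
    · rw [sub_eq_iff_eq_add] at he
      rw [he]; abel

/-- The unfoldings of the orbits of even period are translations in the group generated by the
reflections in the sides. -/
theorem Orbit.IsUnfolding.exists_int (hT : T.Equilateral) {α : PeriodicCurve T}
    (hα : Even α.period) {P Q : Plane} (h : α.orbit.IsUnfolding P Q) :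
    ∃ k l : ℤ, 3 ∣ k - l ∧ 0 ≤ k ∧ k ≤ l ∧ 0 < l ∧ Q = P + frame T ((k : ℝ), (l : ℝ)) ∧
      (α.period : ℤ) = 2 * (k + l) := by
  obtain ⟨β, hβ, h⟩ := h
  obtain ⟨rfl, h0, w', hw', hsec, rfl⟩ := (β.unfoldsTo_iff hT _ _).1 h
  obtain ⟨w, hw⟩ := α.nonsingular.exists_departsWith α.a
  obtain ⟨i, s, hs, he⟩ :=
    (PeriodicCurve.orbit_eq_iff.1 hβ.symm).exists_pointGroup hT hw hw'
  rcases (α.translation_or_fagnano hT hw).2 with ⟨k, l, hkl, hv, hp⟩ | ⟨J, hJ, -, hp⟩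
  · rw [hv] at he
    -- The symmetries permute `|k|`, `|l|` and `|k + l|`, so moving the vector into the sector
    -- preserves the period formula.
    obtain ⟨k', l', hkl', he', hsum⟩ : ∃ k' l' : ℤ, 3 ∣ k' - l' ∧
        s • pointGroup i ((k : ℝ), (l : ℝ)) = ((k' : ℝ), (l' : ℝ)) ∧
        k'.natAbs + l'.natAbs + (k' + l').natAbs = k.natAbs + l.natAbs + (k + l).natAbs := by
      rcases hs with rfl | rfl <;> fin_cases i
      · exact ⟨k, l, by omega, by simp [pointGroup], by omega⟩
      · exact ⟨-k - l, k, by omega, by simp [pointGroup], by omega⟩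
      · exact ⟨l, -k - l, by omega, by simp [pointGroup], by omega⟩
      · exact ⟨k + l, -l, by omega, by simp [pointGroup], by omega⟩
      · exact ⟨-l, -k, by omega, by simp [pointGroup], by omega⟩
      · exact ⟨-k, k + l, by omega, by simp [pointGroup], by omega⟩
      · exact ⟨-k, -l, by omega, by simp [pointGroup], by omega⟩
      · exact ⟨k + l, -k, by omega, by simp [pointGroup]; ring, by omega⟩
      · exact ⟨-l, k + l, by omega, by simp [pointGroup]; ring, by omega⟩
      · exact ⟨-k - l, l, by omega, by simp [pointGroup]; ring, by omega⟩
      · exact ⟨l, k, by omega, by simp [pointGroup], by omega⟩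
      · exact ⟨k, -k - l, by omega, by simp [pointGroup]; ring, by omega⟩
    rw [he'] at he
    have hpos := sub_pos.2 β.a_lt_b
    have h2 := hw'.dbary_pos hT β.nonsingular ((β.nonsingular.mem_side_iff _ 0).1 h0)
    have e1 : (β.b - β.a) * (cv T w').1 = k' := congrArg Prod.fst he
    have e2 : (β.b - β.a) * (cv T w').2 = l' := congrArg Prod.snd he
    have hk : 0 ≤ k' := by
      have : (0 : ℝ) ≤ k' := by rw [← e1]; exact mul_nonneg hpos.le hsec.1
      exact_mod_cast this
    have hl : 0 < l' := by
      have : (0 : ℝ) < l' := by rw [← e2]; exact mul_pos hpos h2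
      exact_mod_cast this
    have hle : k' ≤ l' := by
      have : (k' : ℝ) ≤ l' := by
        rw [← e1, ← e2]; exact mul_le_mul_of_nonneg_left hsec.2 hpos.le
      exact_mod_cast this
    refine ⟨k', l', hkl', hk, hle, hl, ?_, by omega⟩
    rw [← he, map_smul, frame_cv]
  · rw [hp] at hα
    rw [Nat.even_iff] at hα
    omega

/-- A segment, beginning on `BC`, along a translation of the group generated by the reflections in
the sides, is the unfolding of an orbit if its line contains no vertex of the tessellation. -/
theorem exists_orbit (hT : T.Equilateral) {P : Plane} (hP : P ∈ side T 0) {k l : ℤ}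
    (hkl : 3 ∣ k - l) (hk : 0 ≤ k) (hle : k ≤ l) (hl : 0 < l)
    (hlat : ∀ c : ℝ, ¬ IsLat (co T P + c • ((k : ℝ), (l : ℝ)))) :
    ∃ o : Orbit T, o.IsUnfolding P (P + frame T ((k : ℝ), (l : ℝ))) := by
  have hv : ((k : ℝ), (l : ℝ)) ≠ 0 := by
    intro h
    have : (l : ℝ) = 0 := congrArg Prod.snd h
    have : l = 0 := by exact_mod_cast this
    omega
  obtain ⟨htri, h0⟩ := (mem_side_iff T P 0).1 hP
  let α := foldedCurve T hT (co T P) hkl hv hlat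
  have hr : Rel (co T P + (0 : ℝ) • ((k : ℝ), (l : ℝ))) ((k : ℝ), (l : ℝ)) (co T P)
      ((k : ℝ), (l : ℝ)) := by
    rw [zero_smul, add_zero]; exact Rel.refl _ _
  have hstart : α.toFun α.a = P := by
    change pt T (fold (co T P + (0 : ℝ) • ((k : ℝ), (l : ℝ)))) = P
    rw [hr.fold_eq htri, pt_co]
  refine ⟨α.orbit, α, rfl, (α.unfoldsTo_iff hT _ _).2 ⟨hstart, hP, frame T ((k : ℝ), (l : ℝ)),
    foldedLine_departsWith hr htri fun i hi => ?_, ?_, ?_⟩⟩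
  · have : i = 0 := by
      by_contra hne
      exact hlat 0 (by
        rw [zero_smul, add_zero]; exact isLat_of_two_bary_eq_zero hne hi h0)
    rw [this]
    change (0 : ℝ) < l
    exact_mod_cast hl
  · rw [cv_frame]
    exact ⟨by simpa using hk, by simpa using hle⟩
  · change _ = P + ((1 : ℝ) - 0) • _
    rw [sub_zero, one_smul]

/-! ### Fundamental origins and the cardinality of a class -/

/-- A non-horizontal line with integral direction through a vertex meets the horizontal axis at a
rational abscissa. So any point of `BC` with irrational abscissa serves as an origin for all vectors
at once. -/
theorem not_isLat_of_irrational {r : ℝ} (hr : Irrational r) {k l : ℤ} (hl : l ≠ 0) (c : ℝ) :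
    ¬ IsLat ((r, 0) + c • ((k : ℝ), (l : ℝ))) := by
  rintro ⟨i, j, h⟩
  have h1 : r + c * k = i := congrArg Prod.fst h
  have h2 : 0 + c * l = j := congrArg Prod.snd h
  have hl' : (l : ℝ) ≠ 0 := by exact_mod_cast hl
  refine hr ⟨i - j / l * k, ?_⟩
  push_cast
  rw [← h1, ← h2]
  field_simp
  ring

theorem pt_mem_side {r : ℝ} (h0 : 0 ≤ r) (h1 : r ≤ 1) : pt T (r, 0) ∈ side T 0 := by
  rw [mem_side_iff, co_pt, tri_iff]
  refine ⟨⟨h0, le_rfl, by simpa using h1⟩, rfl⟩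

theorem exists_isFundamentalOrigin (hT : T.Equilateral) : ∃ O, IsFundamentalOrigin T O := by
  obtain ⟨r, hr, h0, h1⟩ := exists_irrational_btwn (zero_lt_one (α := ℝ))
  refine ⟨pt T (r, 0), pt_mem_side h0.le h1.le, fun h => ?_, fun α hα P Q hPQ => ?_⟩
  · have h2 := congrArg (co T) h
    rw [co_pt] at h2
    have h3 := h2.trans (co_midpoint (T := T) 0)
    have h4 : r = 1 / 2 := congrArg Prod.fst h3
    exact hr ⟨1 / 2, by rw [h4]; norm_num⟩
  · obtain ⟨k, l, -, -, -, hl, rfl, -⟩ := hPQ.exists_int hT hα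
    rw [Set.disjoint_left]
    intro x hx
    rw [mem_tessellationVertices_iff]
    rw [segment_eq_image'] at hx
    obtain ⟨c, -, rfl⟩ := hx
    have e : P + frame T ((k : ℝ), (l : ℝ)) + (pt T (r, 0) - P) - pt T (r, 0) =
        frame T ((k : ℝ), (l : ℝ)) := by abel
    simp only [e]
    rw [← pt_add_smul, co_pt]
    exact not_isLat_of_irrational hr hl.ne' c

theorem PeriodicCurve.countable_strikes (hT : T.Equilateral) (α : PeriodicCurve T) :
    α.strikes.Countable := by
  obtain ⟨w, hw⟩ := α.nonsingular.exists_departsWith α.a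
  have h : α.strikes = ⋃ j, ⋃ n : ℤ,
      {t | fam j (co T (α.toFun α.a)) + (t - α.a) * fam j (cv T w) = n} := by
    rw [α.strikes_eq hT hw]
    ext t
    simp [OnGrid, fam_add_smul]
  rw [h]
  refine Set.countable_iUnion fun j => Set.countable_iUnion fun n => Set.Subsingleton.countable ?_
  intro x hx y hy
  simp only [Set.mem_ofPred_eq] at hx hy
  have h0 : fam j (cv T w) ≠ 0 := by
    intro h0
    rw [h0, mul_zero, add_zero] at hx
    exact α.nonsingular.line_fam hT hw j h0 n hx
  have := mul_right_cancel₀ h0 (add_left_cancel (hx.trans hy.symm))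
  linarith

/-- The initial abscissa of an unfolding is, up to relabelling, a barycentric coordinate of a point
where the orbit strikes a side. -/
theorem Orbit.countable_unfoldings (hT : T.Equilateral) (o : Orbit T) :
    {r : ℝ | ∃ Q, o.IsUnfolding (pt T (r, 0)) Q}.Countable := by
  obtain ⟨α, rfl⟩ := Quotient.exists_rep o
  refine (Set.countable_iUnion fun j : Fin 3 =>
    (α.countable_strikes hT).image fun t => bary j (co T (α.toFun t))).mono ?_
  rintro r ⟨Q, β, hβ, h⟩
  obtain ⟨ρ, ⟨σ, hρ⟩, m, s, hm, hfun, -⟩ := PeriodicCurve.orbit_eq_iff.1 hβ.symm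
  obtain ⟨hP, h0, -⟩ := (β.unfoldsTo_iff hT _ _).1 h
  have hb : ∀ j, bary (σ.symm j) (co T (α.toFun ((β.a - s) / m))) = bary j (r, 0) := by
    intro j
    rw [← bary_relabel hρ, ← hfun, Equiv.apply_symm_apply, mul_div_cancel₀ _ hm, sub_add_cancel,
      hP, co_pt]
  refine Set.mem_iUnion.2 ⟨σ.symm 2, (β.a - s) / m, ⟨σ.symm 0, ?_⟩, hb 2⟩
  rw [α.nonsingular.mem_side_iff, hb]
  rfl

/-- The class of an orbit of even period has the cardinality of the continuum. -/
theorem Orbit.IsUnfolding.mk_cls (hT : T.Equilateral) {o : Orbit T} {P : Plane} {k l : ℤ}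
    (hkl : 3 ∣ k - l) (hk : 0 ≤ k) (hle : k ≤ l) (hl : 0 < l)
    (h : o.IsUnfolding P (P + frame T ((k : ℝ), (l : ℝ)))) : #o.cls = 𝔠 := by
  have hmem : ∀ {o' : Orbit T}, o' ∈ o.cls ↔
      ∃ R, o'.IsUnfolding R (R + frame T ((k : ℝ), (l : ℝ))) := by
    intro o'
    rw [h.mem_cls_iff hT]
    constructor
    · rintro ⟨R, S, h1, h2⟩
      rw [add_sub_cancel_left, sub_eq_iff_eq_add, add_comm] at h2
      exact ⟨R, by rwa [← h2]⟩
    · rintro ⟨R, h1⟩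
      exact ⟨R, _, h1, by simp⟩
  apply le_antisymm
  -- An orbit of the class is determined by the initial point of an unfolding, hence by a real
  -- number.
  · choose! R hR using fun o' => (hmem (o' := o')).1
    rw [← Cardinal.mk_real]
    refine Cardinal.mk_le_of_injective (f := fun x : o.cls => (co T (R x)).1) ?_
    rintro ⟨x, hx⟩ ⟨y, hy⟩ hxy
    have hx' := hR x hx
    have hy' := hR y hy
    have e : R x = R y := by
      apply co_injective T
      rw [co_of_mem_side hx'.mem_side, co_of_mem_side hy'.mem_side]
      exact Prod.ext hxy rfl
    rw [← e] at hy'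
    exact Subtype.ext (hx'.eq hT hy')
  · by_contra! hlt
    -- Were the class smaller than the continuum, the rationals and its countable sets of abscissas
    -- could not cover the interval.
    have hsub : Set.Ioo (0 : ℝ) 1 ⊆ Set.range ((↑) : ℚ → ℝ) ∪
        ⋃ o' : o.cls, {r : ℝ | ∃ Q, o'.1.IsUnfolding (pt T (r, 0)) Q} := by
      intro r hr
      by_cases hq : r ∈ Set.range ((↑) : ℚ → ℝ)
      · exact Or.inl hq
      · obtain ⟨o', ho'⟩ := exists_orbit hT (pt_mem_side (T := T) hr.1.le hr.2.le) hkl hk hle hl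
          fun c => by rw [co_pt]; exact not_isLat_of_irrational hq hl.ne' c
        exact Or.inr (Set.mem_iUnion.2 ⟨⟨o', hmem.2 ⟨_, ho'⟩⟩, _, ho'⟩)
    have h1 := Cardinal.mk_le_mk_of_subset hsub
    rw [Cardinal.mk_Ioo_real zero_lt_one] at h1
    have h2 := h1.trans (Cardinal.mk_union_le _ _)
    refine absurd h2 (not_le.2 (Cardinal.add_lt_of_lt Cardinal.aleph0_le_continuum ?_ ?_))
    · exact (Cardinal.le_aleph0_iff_set_countable.2 (Set.countable_range _)).trans_lt
        Cardinal.aleph0_lt_continuum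
    · refine (Cardinal.mk_iUnion_le _).trans_lt
        (Cardinal.mul_lt_of_lt Cardinal.aleph0_le_continuum hlt ?_)
      refine (ciSup_le' fun x => ?_).trans_lt Cardinal.aleph0_lt_continuum
      exact Cardinal.le_aleph0_iff_set_countable.2 (x.1.countable_unfoldings hT)

/-- The line through a fundamental origin in the direction of the unfolding of an orbit of even
period contains no vertices of the tessellation. -/
theorem IsFundamentalOrigin.not_isLat {O : Plane} (hO : IsFundamentalOrigin T O)
    {α : PeriodicCurve T} (hα : Even α.period) {P : Plane} {k l : ℤ}
    (h : α.orbit.IsUnfolding P (P + frame T ((k : ℝ), (l : ℝ)))) (c : ℝ) :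
    ¬ IsLat (co T O + c • ((k : ℝ), (l : ℝ))) := by
  rintro ⟨i, j, hij⟩
  have hd := hO.nonsingular α hα _ _ h
  rw [Set.disjoint_left] at hd
  -- Only one segment is known to miss the vertices; translating by multiples of its integral vector
  -- extends this to the whole line.
  refine @hd (O + Int.fract c • frame T ((k : ℝ), (l : ℝ))) ?_ ?_
  · rw [segment_eq_image']
    refine ⟨Int.fract c, ⟨Int.fract_nonneg c, (Int.fract_lt_one c).le⟩, ?_⟩
    have e : P + frame T ((k : ℝ), (l : ℝ)) + (O - P) - O = frame T ((k : ℝ), (l : ℝ)) := by abel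
    simp only [e]
  · rw [mem_tessellationVertices_iff, co_add_smul, cv_frame]
    refine ⟨i - ⌊c⌋ * k, j - ⌊c⌋ * l, ?_⟩
    have h1 : (co T O).1 + c * k = i := congrArg Prod.fst hij
    have h2 : (co T O).2 + c * l = j := congrArg Prod.snd hij
    have h3 : Int.fract c = c - ⌊c⌋ := rfl
    refine Prod.ext ?_ ?_
    · change (co T O).1 + Int.fract c * k = ((i - ⌊c⌋ * k : ℤ) : ℝ)
      push_cast
      rw [h3, ← h1]; ring
    · change (co T O).2 + Int.fract c * l = ((j - ⌊c⌋ * l : ℤ) : ℝ)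
      push_cast
      rw [h3, ← h2]; ring

end Billiard

end

theorem theorem3p3 (T : Affine.Triangle ℝ Billiard.Plane) (hT : T.Equilateral) :
    (∃ O : Billiard.Plane, Billiard.IsFundamentalOrigin T O) ∧
    ∀ O : Billiard.Plane, Billiard.IsFundamentalOrigin T O → ∀ α : Billiard.PeriodicCurve T,
      (∀ n : ℕ, α.period = 2 * n →
        #α.orbit.cls = 𝔠 ∧
        ∃ x y : ℤ, (0 ≤ x ∧ x ≤ y ∧ x ≡ y [ZMOD 3] ∧ x + y = n) ∧
          (∃! o : Billiard.Orbit T, o ∈ α.orbit.cls ∧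
            o.IsUnfolding O (Billiard.rhombic T O x y)) ∧
          ∀ o ∈ α.orbit.cls, ∀ S : Billiard.Plane,
            o.IsUnfolding O S → S = Billiard.rhombic T O x y) ∧
      (¬ Even α.period →
        ∃ k : ℕ, 1 ≤ k ∧ α.IsFagnanoIterate (2 * k - 1) ∧ α.period = 6 * k - 3) := by
  refine ⟨Billiard.exists_isFundamentalOrigin hT, fun O hO α => ⟨fun n hn => ?_, fun hodd => ?_⟩⟩
  · have heven : Even α.period := ⟨n, by omega⟩
    obtain ⟨P, Q, h⟩ := α.orbit.exists_isUnfolding hT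
    obtain ⟨k, l, hkl, hk, hle, hl, rfl, hsum⟩ := h.exists_int hT heven
    obtain ⟨o, ho⟩ := Billiard.exists_orbit hT hO.mem_side hkl hk hle hl (hO.not_isLat heven h)
    refine ⟨h.mk_cls hT hkl hk hle hl, k, l, ⟨hk, hle, ?_, by omega⟩, ⟨o, ⟨?_, ?_⟩, ?_⟩, ?_⟩
    · rw [Int.modEq_iff_dvd]; omega
    · exact (h.mem_cls_iff hT).2 ⟨_, _, ho, by simp⟩
    · rwa [Billiard.rhombic_eq]
    · rintro o' ⟨-, ho'⟩
      rw [Billiard.rhombic_eq] at ho'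
      exact ho'.eq hT ho
    · intro o' ho' S hS
      obtain ⟨R, S', h1, h2⟩ := (h.mem_cls_iff hT).1 ho'
      have h3 := (hS.sub_eq_sub hT h1).trans h2
      rw [add_sub_cancel_left, sub_eq_iff_eq_add, add_comm] at h3
      rw [Billiard.rhombic_eq, h3]
  · obtain ⟨w, hw⟩ := α.nonsingular.exists_departsWith α.a
    rcases (α.translation_or_fagnano hT hw).2 with ⟨k, l, -, -, hp⟩ | ⟨J, hJ, hF, hp⟩
    -- The sum `|k| + |l| + |k + l|` is always even.
    · refine absurd (Nat.even_iff.2 ?_) hodd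
      omega
    · refine ⟨(J + 1) / 2, by omega, ?_, by omega⟩
      have e : 2 * ((J + 1) / 2) - 1 = J := by omega
      rwa [e]
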